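/- Let $K$, $N_B$, $N_R$ be numbers of strong users, base-station antennas and reflecting elements, let $L_G>0$, $\bar p>0$, let $a\in\mathbb C^{N_R}$ with $\|a\|_2^2=N_R$ and $b\in\mathbb C^{N_B}$ with $\|b\|_2=1$. Let $h_{d,k}$ (in $\mathbb C^{N_B}$) and $h_{r,k}$ (in $\mathbb C^{N_R}$), $k\le K$, be the random direct and reflecting channels of the strong users, $h_{r,K+1}$ the random reflecting channel of the weak user (which has no direct channel), and $\theta$ a random vector in $\mathbb C^{N_R}$ of phase shifts, $|\theta_n|=1$ for all $n$. The cascaded channels are $h_{c,k}^H=\sqrt{L_GN_B}\,h_{r,k}^H\operatorname{diag}(a)$. Put $H_d=[h_{d,1},\dots,h_{d,K}]^H$, $H_c=[h_{c,1},\dots,h_{c,K}]^H$, $C_s=H_d(I-bb^H)H_d^H$, $D_s=[H_c,\;H_db]$, $\bar\theta=[\theta^H\;1]^H$. The weak user's part of the high-SNR rate of linear precoding is $$\overline{SE}_{Lin,r}=\log_2\!\left(\frac{|h_{c,K+1}^H\theta|^2\,\bar p}{1+\bar\theta^HD_s^HC_s^{-1}D_s\bar\theta}\right),$$ where almost surely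 $C_s$ is invertible and $h_{c,K+1}^H\theta\ne0$. Assume Rayleigh fading for the reflecting channels of the strong users: $h_{r,1},\dots,h_{r,K}$ are independent and $h_{r,k}\sim\mathcal{CN}(0,R_{r,k})$ (circularly symmetric complex Gaussian, $R_{r,k}$ possibly singular). Assume further that $(h_{r,k})_{k\le K}$ is independent of $(h_{d,k})_{k\le K}$, that $\theta$ is independent of the pair formed by these two families (this covers random phases, phases chosen from the channel statistics, and phases that depend only on a weak-user channel independent of the strong users' channels), and that the $h_{d,k}$ have finite second moments. The joint distribution of the direct channels and the distribution of $h_{r,K+1}$ are otherwise arbitrary. Let $R_{d,k}=\mathbb E[h_{d,k}h_{d,k}^H]$ (the covariance matrix if $h_{d,k}$ is centred) and $R_{c,k}=\mathbb E[h_{c,k}h_{c,k}^H]$, and let $\gamma$ be the Euler–Mascheroni constant. Then $R_{c,k}=L_GN_B\operatorname{diag}(a^*)R_{r,k}\operatorname{diag}(a)$ for all $k\le K$, and $$\mathbb E\big[\overline{SE}_{Lin,r}\big]\;\le\;\mathbb E\!\left[\log_2\!\left(\frac{|h_{c,K+1}^H\theta|^2\,\bar p}{e^{-\gamma}\sum_{k=1}^K\frac{\theta^HR_{c,k}\theta}{\operatorname{tr}R_{d,k}}}\right)\right]$$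 whenever the expectation on the right exists in $[-\infty,\infty]$ (the logarithm being $+\infty$ where its denominator vanishes). If the right-hand side is not $+\infty$, the expectation on the left exists in $[-\infty,\infty)$ as well. -/

import Mathlib

open MeasureTheory ProbabilityTheory Matrix
open scoped ENNReal

namespace RIS

noncomputable section

/-! ### Expectations with values in `[-∞, ∞]` -/

/-- The expectation `E[X⁺] - E[X⁻]` of an extended real random variable. It is meaningful when
`ExpectationExists P X` holds. -/
def expectation {Ω : Type*} [MeasurableSpace Ω] (P : Measure Ω) (X : Ω → EReal) : EReal :=
  ((∫⁻ ω, (X ω).toENNReal ∂P : ℝ≥0∞) : EReal) - ((∫⁻ ω, (-X ω).toENNReal ∂P : ℝ≥0∞) : EReal)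

/-- The expectation of `X` exists in `[-∞, ∞]`: not both `E[X⁺]` and `E[X⁻]` are infinite. -/
def ExpectationExists {Ω : Type*} [MeasurableSpace Ω] (P : Measure Ω) (X : Ω → EReal) : Prop :=
  ∫⁻ ω, (X ω).toENNReal ∂P ≠ ⊤ ∨ ∫⁻ ω, (-X ω).toENNReal ∂P ≠ ⊤

/-- For an integrable real random variable this is the usual expectation. -/
theorem expectation_coe {Ω : Type*} [MeasurableSpace Ω] {P : Measure Ω} {f : Ω → ℝ}
    (hf : Integrable f P) :
    expectation P (fun ω => (f ω : EReal)) = ((∫ ω, f ω ∂P : ℝ) : EReal) := by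
  have h1 : ∫⁻ ω, ENNReal.ofReal (f ω) ∂P ≠ ⊤ := hf.lintegral_lt_top.ne
  have h2 : ∫⁻ ω, ENNReal.ofReal (-f ω) ∂P ≠ ⊤ := hf.neg.lintegral_lt_top.ne
  have e2 : ∀ ω, (-(f ω : EReal)).toENNReal = ENNReal.ofReal (-f ω) := fun ω => by
    rw [← EReal.coe_neg, EReal.real_coe_toENNReal]
  simp only [expectation, EReal.real_coe_toENNReal, e2]
  rw [integral_eq_lintegral_pos_part_sub_lintegral_neg_part hf, EReal.coe_sub,
    EReal.coe_ennreal_toReal h1, EReal.coe_ennreal_toReal h2]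

/-- The logarithm to base 2 on `[0, ∞]`, with `log₂ 0 = -∞` and `log₂ ∞ = ∞`. -/
def elog2 (x : ℝ≥0∞) : EReal := ENNReal.log x / ((Real.log 2 : ℝ) : EReal)

/-- On positive reals this is the usual logarithm to base 2. -/
theorem elog2_ofReal {x : ℝ} (hx : 0 < x) :
    elog2 (ENNReal.ofReal x) = ((Real.logb 2 x : ℝ) : EReal) := by
  rw [elog2, ENNReal.log_ofReal_of_pos hx, ← EReal.coe_div, Real.logb]

/-! ### Random vectors -/

/-- The matrix of second moments `E[X Xᴴ]`. -/
def secondMoment {Ω : Type*} [MeasurableSpace Ω] (P : Measure Ω) {n : ℕ}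
    (X : Ω → Fin n → ℂ) : Matrix (Fin n) (Fin n) ℂ :=
  Matrix.of fun i j => ∫ ω, X ω i * star (X ω j) ∂P

/-- `X ∼ CN(0, R)`: `X` is a circularly symmetric complex Gaussian vector with covariance `R`, i.e.
it is jointly Gaussian (over `ℝ`), centred, with `E[X Xᴴ] = R` and `E[X Xᵀ] = 0`. -/
structure IsComplexNormal {Ω : Type*} [MeasurableSpace Ω] (P : Measure Ω) {n : ℕ}
    (X : Ω → Fin n → ℂ) (R : Matrix (Fin n) (Fin n) ℂ) : Prop where
  gaussian : HasGaussianLaw X P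
  mean : ∀ i, ∫ ω, X ω i ∂P = 0
  covariance : secondMoment P X = R
  pseudo : ∀ i j, ∫ ω, X ω i * X ω j ∂P = 0

/-! ### The channel model -/

/-- The matrix `[h₁, …, h_K]ᴴ` whose `k`-th row is `h_kᴴ`. -/
def stack {K n : ℕ} (h : Fin K → Fin n → ℂ) : Matrix (Fin K) (Fin n) ℂ :=
  Matrix.of fun k => star (h k)

/-- The cascaded channel `h_c`, given by `h_cᴴ = √(L_G N_B) h_rᴴ diag(a)`. -/
def cascaded (NB : ℕ) {NR : ℕ} (LG : ℝ) (a : Fin NR → ℂ) (hr : Fin NR → ℂ) : Fin NR → ℂ :=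
  star (((Real.sqrt (LG * NB) : ℝ) : ℂ) • (star hr ᵥ* diagonal a))

/-- The projector `I - b bᴴ` onto the orthogonal complement of the unit vector `b`. -/
def projPerp {NB : ℕ} (b : Fin NB → ℂ) : Matrix (Fin NB) (Fin NB) ℂ :=
  1 - vecMulVec b (star b)

/-- `C_s = H_d (I - b bᴴ) H_dᴴ`. -/
def Cs {K NB : ℕ} (b : Fin NB → ℂ) (Hd : Matrix (Fin K) (Fin NB) ℂ) :
    Matrix (Fin K) (Fin K) ℂ :=
  Hd * projPerp b * Hdᴴ

/-- `D_s = [H_c, H_d b]`. -/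
def Ds {K NB NR : ℕ} (b : Fin NB → ℂ) (Hd : Matrix (Fin K) (Fin NB) ℂ)
    (Hc : Matrix (Fin K) (Fin NR) ℂ) : Matrix (Fin K) (Fin NR ⊕ Unit) ℂ :=
  fromCols Hc (replicateCol Unit (Hd *ᵥ b))

/-- `θ̄ = [θᴴ 1]ᴴ`. -/
def thetaBar {NR : ℕ} (θ : Fin NR → ℂ) : Fin NR ⊕ Unit → ℂ :=
  Sum.elim θ (fun _ => 1)

/-- The mitigation term `θ̄ᴴ D_sᴴ C_s⁻¹ D_s θ̄` (a nonnegative real number when `C_s` is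
invertible). -/
def mitigation {K NB NR : ℕ} (b : Fin NB → ℂ) (Hd : Matrix (Fin K) (Fin NB) ℂ)
    (Hc : Matrix (Fin K) (Fin NR) ℂ) (θ : Fin NR → ℂ) : ℝ :=
  (star (thetaBar θ) ⬝ᵥ (((Ds b Hd Hc)ᴴ * (Cs b Hd)⁻¹ * Ds b Hd Hc) *ᵥ thetaBar θ)).re

/-- The part of the high-SNR linear-precoding rate that belongs to the weak user,
`log₂ (|hᴴ θ|² p̄ / (1 + θ̄ᴴ D_sᴴ C_s⁻¹ D_s θ̄))`, where `h` is the weak user's cascaded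
channel. -/
def rateLinR {K NB NR : ℕ} (pbar : ℝ) (b : Fin NB → ℂ) (Hd : Matrix (Fin K) (Fin NB) ℂ)
    (Hc : Matrix (Fin K) (Fin NR) ℂ) (h : Fin NR → ℂ) (θ : Fin NR → ℂ) : ℝ :=
  Real.logb 2 (‖star h ⬝ᵥ θ‖ ^ 2 * pbar / (1 + mitigation b Hd Hc θ))

/-- The bound `log₂ (|hᴴ θ|² p̄ / (e^{-γ} ∑ₖ θᴴ R_{c,k} θ / tr R_{d,k}))`, which is `∞` where only
its denominator vanishes. -/
def rateBound {K NB NR : ℕ} (pbar : ℝ) (Rc : Fin K → Matrix (Fin NR) (Fin NR) ℂ)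
    (Rd : Fin K → Matrix (Fin NB) (Fin NB) ℂ) (h : Fin NR → ℂ) (θ : Fin NR → ℂ) : EReal :=
  elog2 (ENNReal.ofReal (‖star h ⬝ᵥ θ‖ ^ 2 * pbar) /
    ENNReal.ofReal (Real.exp (-Real.eulerMascheroniConstant) *
      ∑ k, (star θ ⬝ᵥ (Rc k *ᵥ θ)).re / (Rd k).trace.re))

end

end RIS

/-! Since $|h_{c,K+1}^H\theta|^2\bar p$ occurs on both sides, the claim reduces to $\mathbb
E\log(1+m)\ge\mathbb E\log T-\gamma$, with $m$ the mitigation term, $T=\sum_k l_k/t_k$,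
$l_k=\theta^HR_{c,k}\theta$ and $t_k=\operatorname{tr}R_{d,k}$.

Fix $\theta$ and $H_d$. The zero-forcing matrix $L$ satisfies $H_dL=1$ and $L^HL=C_s^{-1}$, so
$m=\|L(H_c\theta+H_db)\|^2$ is a sum of squares $|Y_i+c_i|^2$ with $Y_i$ circular Gaussian and $c_i$
constant. For a single coordinate, Jensen's formula on circles removes the shift, and the log-moment
of an exponential variable gives $\log s-\gamma$ (`IsCircularGaussian.log_sub_le_integral_log`).
Concavity of the logarithm extends this to sums, with $s$ replaced by the total variance
(`log_sub_le_integral_log_one_add_sum_sq`). By Cauchy–Schwarz that variance is at least $\sum_k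
l_k/\|h_{d,k}\|^2$ (`inv_sum_le_sum_zeroForcing`).

To average over $H_d$, `log_sum_div_add_le` bounds $\log\sum_k l_k/x_k$ below by a function affine
in $x$ whose mean at $x_k=\|h_{d,k}\|^2$ is exactly $\log T$; no joint law of the direct channels is
needed. Independence and Fubini then average over $\theta$. As the weak user's log-power need not be
integrable, `expectation_sub_div_le` restores it on both sides. -/

/-! ### Logarithmic moment of the exponential law -/

/-- This is $\Gamma'(1)$, computed by differentiating the Gamma integral under the integral sign. -/
theorem integral_log_mul_exp_neg_Ioi :
    ∫ t in Set.Ioi (0 : ℝ), Real.log t * Real.exp (-t) = -Real.eulerMascheroniConstant := by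
  have h1 := Complex.hasDerivAt_GammaIntegral (s := 1) (by simp)
  have h2 : HasDerivAt Complex.GammaIntegral (-(Real.eulerMascheroniConstant : ℂ)) 1 := by
    refine Complex.hasDerivAt_Gamma_one.congr_of_eventuallyEq ?_
    have : {s : ℂ | 0 < s.re} ∈ nhds (1 : ℂ) :=
      (isOpen_lt continuous_const Complex.continuous_re).mem_nhds (by simp)
    filter_upwards [this] with s hs
    rw [Complex.Gamma_eq_integral hs]
  have h3 := h1.unique h2
  simp only [sub_self, Complex.cpow_zero, one_mul] at h3
  rw [← Complex.ofReal_inj, ← integral_complex_ofReal]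
  push_cast
  rw [← h3]
  simp

theorem integrableOn_log_mul_exp_neg_Ioi :
    IntegrableOn (fun t => Real.log t * Real.exp (-t)) (Set.Ioi (0 : ℝ)) := by
  -- A non-integrable function would have integral $0$ by convention, but $-\gamma\ne0$.
  by_contra h
  have h1 := integral_log_mul_exp_neg_Ioi
  rw [integral_undef h] at h1
  linarith [Real.one_half_lt_eulerMascheroniConstant]

theorem integrableOn_log_mul_exp_neg_div_Ioi {s : ℝ} (hs : 0 < s) :
    IntegrableOn (fun t => Real.log t * Real.exp (-(t / s))) (Set.Ioi (0 : ℝ)) := by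
  have h1 : IntegrableOn (fun t => Real.exp (-t)) (Set.Ioi (0 : ℝ)) := integrableOn_exp_neg_Ioi 0
  have h2 := ((h1.const_mul (Real.log s)).add integrableOn_log_mul_exp_neg_Ioi)
  have h3 := (integrableOn_Ioi_comp_mul_left_iff
    (fun t => Real.log s * Real.exp (-t) + Real.log t * Real.exp (-t)) 0
    (inv_pos.2 hs)).2 (by rw [mul_zero]; exact h2)
  refine h3.congr_fun (fun t ht => ?_) measurableSet_Ioi
  have ht : 0 < t := ht
  simp only
  rw [Real.log_mul (inv_pos.2 hs).ne' ht.ne', Real.log_inv, inv_mul_eq_div]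
  ring

theorem integral_log_mul_exp_neg_div_Ioi {s : ℝ} (hs : 0 < s) :
    ∫ t in Set.Ioi (0 : ℝ), Real.log t * Real.exp (-(t / s)) =
      s * (Real.log s - Real.eulerMascheroniConstant) := by
  have h1 : IntegrableOn (fun t => Real.exp (-t)) (Set.Ioi (0 : ℝ)) := integrableOn_exp_neg_Ioi 0
  have h3 := integral_comp_mul_left_Ioi
    (fun t => Real.log s * Real.exp (-t) + Real.log t * Real.exp (-t)) 0 (inv_pos.2 hs)
  rw [mul_zero, integral_add (h1.const_mul _) integrableOn_log_mul_exp_neg_Ioi,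
    integral_const_mul, integral_exp_neg_Ioi_zero, integral_log_mul_exp_neg_Ioi, inv_inv,
    smul_eq_mul] at h3
  rw [show s * (Real.log s - Real.eulerMascheroniConstant) =
    s * (Real.log s * 1 + -Real.eulerMascheroniConstant) by ring, ← h3]
  refine setIntegral_congr_fun measurableSet_Ioi (fun t ht => ?_)
  have ht : 0 < t := ht
  rw [Real.log_mul (inv_pos.2 hs).ne' ht.ne', Real.log_inv, inv_mul_eq_div]
  ring

theorem integrableOn_mul_log_sq_mul_exp {s : ℝ} (hs : 0 < s) :
    IntegrableOn (fun r : ℝ => r * (Real.exp (-(r ^ 2 / s)) * Real.log (r ^ 2)))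
      (Set.Ioi (0 : ℝ)) := by
  have h := (integrableOn_Ioi_comp_rpow_iff (fun t => Real.log t * Real.exp (-(t / s)))
    (p := 2) two_ne_zero).2 (integrableOn_log_mul_exp_neg_div_Ioi hs)
  refine IntegrableOn.congr_fun (h.const_mul 2⁻¹) (fun r hr => ?_) measurableSet_Ioi
  simp only [smul_eq_mul, Real.rpow_two, abs_two]
  rw [show (2 : ℝ) - 1 = 1 by norm_num, Real.rpow_one]
  ring

theorem integral_mul_log_sq_mul_exp {s : ℝ} (hs : 0 < s) :
    ∫ r in Set.Ioi (0 : ℝ), r * (Real.exp (-(r ^ 2 / s)) * Real.log (r ^ 2)) =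
      s / 2 * (Real.log s - Real.eulerMascheroniConstant) := by
  have h := integral_comp_rpow_Ioi_of_pos (g := fun t => Real.log t * Real.exp (-(t / s)))
    (p := 2) two_pos
  rw [integral_log_mul_exp_neg_div_Ioi hs] at h
  rw [div_mul_eq_mul_div, ← h, eq_div_iff two_ne_zero, ← integral_mul_const]
  refine setIntegral_congr_fun measurableSet_Ioi (fun r hr => ?_)
  simp only [smul_eq_mul, Real.rpow_two]
  rw [show (2 : ℝ) - 1 = 1 by norm_num, Real.rpow_one]
  ring

/-! ### Circle averages and polar coordinates -/

/-- By Jensen's formula the circle average of $\log|z+c|$ is $\log r+\log^+(|c|/r)\ge\log r$. This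
makes the final bound independent of the shift $c$. -/
theorem log_sq_le_circleAverage_log (c : ℂ) {r : ℝ} (hr : 0 < r) :
    Real.log (r ^ 2) ≤ Real.circleAverage (fun z => Real.log (1 + ‖z + c‖ ^ 2)) 0 r := by
  have hcont : Continuous fun z : ℂ => Real.log (1 + ‖z + c‖ ^ 2) :=
    Continuous.log (by fun_prop) (fun z => by positivity)
  have h1 := circleAverage_log_norm_sub_const_eq_log_radius_add_posLog (a := -c) (c := 0) hr.ne'
  have h2 : Real.log r ≤ Real.circleAverage (fun z => Real.log ‖z - -c‖) 0 r := by
    rw [h1]; linarith [Real.posLog_nonneg (x := r⁻¹ * ‖(0 : ℂ) - -c‖)]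
  have hi := circleIntegrable_log_norm_sub_const (a := -c) (c := 0) r
  calc Real.log (r ^ 2) = (2 : ℝ) • Real.log r := by rw [Real.log_pow]; simp
    _ ≤ (2 : ℝ) • Real.circleAverage (fun z => Real.log ‖z - -c‖) 0 r := by
      simp only [smul_eq_mul]; linarith
    _ = Real.circleAverage (fun z => (2 : ℝ) • Real.log ‖z - -c‖) 0 r :=
      (Real.circleAverage_fun_smul ..).symm
    _ ≤ _ := by
      refine Real.circleAverage_mono (hi.const_fun_smul (a := (2 : ℝ)))
        hcont.continuousOn.circleIntegrable' (fun z _ => ?_)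
      simp only [sub_neg_eq_add, smul_eq_mul]
      rw [show (2 : ℝ) * Real.log ‖z + c‖ = Real.log (‖z + c‖ ^ 2) by rw [Real.log_pow]; simp]
      -- At the singularity `Real.log 0 = 0`, so monotonicity of the logarithm does not apply; both
      -- sides are $0$.
      by_cases hz : z + c = 0
      · rw [hz, norm_zero, zero_pow two_ne_zero, Real.log_zero, add_zero, Real.log_one]
      · exact Real.log_le_log (by positivity) (by linarith)

theorem circleAverage_zero_eq_setIntegral (f : ℂ → ℝ) (r : ℝ) :
    ∫ φ in Set.Ioo (-Real.pi) Real.pi, f (r * (Real.cos φ + Real.sin φ * Complex.I)) =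
      2 * Real.pi * Real.circleAverage f 0 r := by
  rw [Real.circleAverage_eq_integral_add (-Real.pi),
    intervalIntegral.integral_comp_add_right (fun θ => f (circleMap 0 r θ)), smul_eq_mul,
    mul_inv_cancel_left₀ (by positivity), show (2 * Real.pi + -Real.pi) = Real.pi by ring, zero_add,
    intervalIntegral.integral_of_le (by linarith [Real.pi_pos]), integral_Ioc_eq_integral_Ioo]
  refine setIntegral_congr_fun measurableSet_Ioo (fun φ _ => ?_)
  simp only [circleMap, zero_add]
  rw [Complex.exp_mul_I]
  push_cast
  rfl

theorem integrableOn_polarCoord_target {f : ℝ × ℝ → ℝ} (hf : Integrable f) (hm : Measurable f) :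
    IntegrableOn (fun p : ℝ × ℝ => p.1 * f (polarCoord.symm p)) polarCoord.target := by
  have hpc : Measurable fun p : ℝ × ℝ => polarCoord.symm p := by
    simp only [polarCoord_symm_apply]; fun_prop
  refine ⟨(measurable_fst.mul (hm.comp hpc)).aestronglyMeasurable, ?_⟩
  have h := lintegral_comp_polarCoord_symm (fun p => ‖f p‖ₑ)
  rw [HasFiniteIntegral]
  refine lt_of_eq_of_lt ?_ (lt_of_eq_of_lt h hf.2)
  refine setLIntegral_congr_fun polarCoord.open_target.measurableSet (fun p hp => ?_)
  have hp1 : 0 < p.1 := hp.1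
  simp only [enorm_mul, smul_eq_mul]
  rw [Real.enorm_of_nonneg hp1.le]

/-- The logarithm of a shifted circularly symmetric Gaussian, in polar coordinates. -/
theorem le_integral_exp_mul_log {s : ℝ} (hs : 0 < s) (c : ℂ)
    (hint : Integrable fun p : ℝ × ℝ => Real.exp (-((p.1 ^ 2 + p.2 ^ 2) / s)) *
      Real.log (1 + ‖(p.1 + p.2 * Complex.I : ℂ) + c‖ ^ 2)) :
    Real.pi * s * (Real.log s - Real.eulerMascheroniConstant) ≤
      ∫ p : ℝ × ℝ, Real.exp (-((p.1 ^ 2 + p.2 ^ 2) / s)) *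
        Real.log (1 + ‖(p.1 + p.2 * Complex.I : ℂ) + c‖ ^ 2) := by
  set f : ℝ × ℝ → ℝ := fun p => Real.exp (-((p.1 ^ 2 + p.2 ^ 2) / s)) *
    Real.log (1 + ‖(p.1 + p.2 * Complex.I : ℂ) + c‖ ^ 2) with hf
  have hm : Measurable f := by rw [hf]; fun_prop
  have hI := integrableOn_polarCoord_target hint hm
  have hfp : ∀ p : ℝ × ℝ, p.1 * f (polarCoord.symm p) = p.1 * (Real.exp (-(p.1 ^ 2 / s)) *
      Real.log (1 + ‖(p.1 * (Real.cos p.2 + Real.sin p.2 * Complex.I) : ℂ) + c‖ ^ 2)) := by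
    intro p
    simp only [hf, polarCoord_symm_apply]
    rw [show (p.1 * Real.cos p.2) ^ 2 + (p.1 * Real.sin p.2) ^ 2 = p.1 ^ 2 by
      linear_combination p.1 ^ 2 * Real.sin_sq_add_cos_sq p.2]
    push_cast
    rw [mul_add, mul_assoc]
  rw [← integral_comp_polarCoord_symm f]
  simp only [smul_eq_mul, hfp, polarCoord_target] at hI ⊢
  rw [Measure.volume_eq_prod] at hI ⊢
  rw [setIntegral_prod _ hI]
  rw [IntegrableOn, ← Measure.prod_restrict] at hI
  -- The Gaussian weight is radial, so the circle bound applies on each circle and leaves an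
  -- integral over $r$ alone.
  calc _ = 2 * Real.pi * ∫ r in Set.Ioi (0 : ℝ),
        r * (Real.exp (-(r ^ 2 / s)) * Real.log (r ^ 2)) := by
        rw [integral_mul_log_sq_mul_exp hs]; ring
    _ ≤ _ := by
      rw [← integral_const_mul]
      refine setIntegral_mono_on ((integrableOn_mul_log_sq_mul_exp hs).const_mul _)
        hI.integral_prod_left measurableSet_Ioi (fun r hr => ?_)
      have hr : 0 < r := hr
      simp only
      simp only [← mul_assoc]
      rw [integral_const_mul]
      simp only [mul_assoc]
      rw [circleAverage_zero_eq_setIntegral (fun z => Real.log (1 + ‖z + c‖ ^ 2)) r]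
      have := log_sq_le_circleAverage_log c hr
      calc _ = (r * Real.exp (-(r ^ 2 / s)) * (2 * Real.pi)) * Real.log (r ^ 2) := by ring
        _ ≤ (r * Real.exp (-(r ^ 2 / s)) * (2 * Real.pi)) *
          Real.circleAverage (fun z => Real.log (1 + ‖z + c‖ ^ 2)) 0 r := by gcongr
        _ = _ := by ring

/-! ### Scalar circular Gaussians -/

/-- `Z` is a scalar circularly symmetric complex Gaussian random variable of variance `s`. -/
structure IsCircularGaussian {Ω : Type*} [MeasurableSpace Ω] (P : Measure Ω) (Z : Ω → ℂ) (s : ℝ) :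
    Prop where
  gaussian : HasGaussianLaw Z P
  mean : ∫ ω, Z ω ∂P = 0
  variance : ∫ ω, ‖Z ω‖ ^ 2 ∂P = s
  pseudo : ∫ ω, Z ω * Z ω ∂P = 0

namespace IsCircularGaussian

variable {Ω : Type*} [MeasurableSpace Ω] {P : Measure Ω} {Z : Ω → ℂ} {s : ℝ}

theorem integrable_re_sq (h : IsCircularGaussian P Z s) :
    Integrable (fun ω => (Z ω).re ^ 2) P := h.gaussian.memLp_two.re.integrable_sq

theorem integrable_im_sq (h : IsCircularGaussian P Z s) :
    Integrable (fun ω => (Z ω).im ^ 2) P := h.gaussian.memLp_two.im.integrable_sq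

theorem integrable_mul_self (h : IsCircularGaussian P Z s) :
    Integrable (fun ω => Z ω * Z ω) P := h.gaussian.memLp_two.integrable_mul h.gaussian.memLp_two

theorem integral_re (h : IsCircularGaussian P Z s) : ∫ ω, (Z ω).re ∂P = 0 := by
  have := _root_.integral_re (𝕜 := ℂ) h.gaussian.integrable
  simpa [h.mean] using this

theorem integral_im (h : IsCircularGaussian P Z s) : ∫ ω, (Z ω).im ∂P = 0 := by
  have := _root_.integral_im (𝕜 := ℂ) h.gaussian.integrable
  simpa [h.mean] using this

theorem integral_re_sq_add (h : IsCircularGaussian P Z s) :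
    ∫ ω, (Z ω).re ^ 2 ∂P + ∫ ω, (Z ω).im ^ 2 ∂P = s := by
  rw [← integral_add h.integrable_re_sq h.integrable_im_sq, ← h.variance]
  refine integral_congr_ae (.of_forall fun ω => ?_)
  simp only [Complex.sq_norm, Complex.normSq_apply]; ring

theorem integral_re_sq_sub (h : IsCircularGaussian P Z s) :
    ∫ ω, (Z ω).re ^ 2 ∂P - ∫ ω, (Z ω).im ^ 2 ∂P = 0 := by
  have := _root_.integral_re (𝕜 := ℂ) h.integrable_mul_self
  rw [h.pseudo] at this
  rw [← integral_sub h.integrable_re_sq h.integrable_im_sq]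
  simp at this
  rw [← this]
  refine integral_congr_ae (.of_forall fun ω => ?_)
  ring

theorem integral_re_mul_im (h : IsCircularGaussian P Z s) :
    ∫ ω, (Z ω).re * (Z ω).im ∂P = 0 := by
  have := _root_.integral_im (𝕜 := ℂ) h.integrable_mul_self
  rw [h.pseudo] at this
  simp at this
  have h2 : ∫ ω, 2 * ((Z ω).re * (Z ω).im) ∂P = 0 := by
    rw [← this]
    refine integral_congr_ae (.of_forall fun ω => ?_)
    simp only; ring
  rw [integral_const_mul] at h2
  simpa using h2

theorem hasGaussianLaw_prod (h : IsCircularGaussian P Z s) :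
    HasGaussianLaw (fun ω => ((Z ω).re, (Z ω).im)) P :=
  h.gaussian.map_fun (Complex.equivRealProdCLM : ℂ →L[ℝ] ℝ × ℝ)

/-- A vanishing pseudo-variance makes the real and imaginary parts uncorrelated with equal variance
$s/2$; joint Gaussianity upgrades this to independence. -/
theorem map_re_im (h : IsCircularGaussian P Z s) :
    P.map (fun ω => ((Z ω).re, (Z ω).im)) =
      (gaussianReal 0 (s / 2).toNNReal).prod (gaussianReal 0 (s / 2).toNNReal) := by
  have hP := h.gaussian.isProbabilityMeasure
  have hG := h.hasGaussianLaw_prod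
  have hre : AEMeasurable (fun ω => (Z ω).re) P := hG.fst.aemeasurable
  have him : AEMeasurable (fun ω => (Z ω).im) P := hG.snd.aemeasurable
  have hind : IndepFun (fun ω => (Z ω).re) (fun ω => (Z ω).im) P := by
    refine hG.indepFun_of_covariance_eq_zero ?_
    rw [covariance_eq_sub hG.fst.memLp_two hG.snd.memLp_two, h.integral_re, h.integral_im]
    simpa using h.integral_re_mul_im
  rw [(indepFun_iff_map_prod_eq_prod_map_map hre him).1 hind, hG.fst.map_eq_gaussianReal,
    hG.snd.map_eq_gaussianReal, h.integral_re, h.integral_im,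
    variance_of_integral_eq_zero hre h.integral_re, variance_of_integral_eq_zero him h.integral_im]
  have h1 := h.integral_re_sq_add
  have h2 := h.integral_re_sq_sub
  congr 3 <;> linarith

theorem integrable_log (h : IsCircularGaussian P Z s) (c : ℂ) :
    Integrable (fun ω => Real.log (1 + ‖Z ω + c‖ ^ 2)) P := by
  have hP := h.gaussian.isProbabilityMeasure
  have h2 : MemLp (fun ω => Z ω + c) 2 P := h.gaussian.memLp_two.add (memLp_const c)
  refine h2.norm.integrable_sq.mono' ?_ (.of_forall fun ω => ?_)
  · have := h2.1.aemeasurable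
    exact (by fun_prop : AEMeasurable _ P).aestronglyMeasurable
  · rw [Real.norm_of_nonneg (Real.log_nonneg (by nlinarith [sq_nonneg ‖Z ω + c‖]))]
    linarith [Real.log_le_sub_one_of_pos (x := 1 + ‖Z ω + c‖ ^ 2) (by positivity)]

/-- The law of $Z$ has the radial density $(\pi s)^{-1}e^{-|z|^2/s}$, which reduces the bound to the
polar computation. -/
theorem log_sub_le_integral_log (h : IsCircularGaussian P Z s) (hs : 0 < s) (c : ℂ) :
    Real.log s - Real.eulerMascheroniConstant ≤ ∫ ω, Real.log (1 + ‖Z ω + c‖ ^ 2) ∂P := by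
  set v := (s / 2).toNNReal with hv
  have hvs : (v : ℝ) = s / 2 := Real.coe_toNNReal _ (by positivity)
  have hv0 : v ≠ 0 := by
    intro h0; rw [h0] at hvs; simp at hvs; linarith
  set f : ℝ × ℝ → ℝ := fun p => Real.log (1 + ‖(p.1 + p.2 * Complex.I : ℂ) + c‖ ^ 2) with hf
  have hfm : Measurable f := by rw [hf]; fun_prop
  have hG := h.hasGaussianLaw_prod
  have hfZ : ∀ ω, Real.log (1 + ‖Z ω + c‖ ^ 2) = f ((Z ω).re, (Z ω).im) := fun ω => by
    simp only [hf, Complex.re_add_im]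
  have hint := h.integrable_log c
  simp only [hfZ] at hint ⊢
  have hmap : P.map (fun ω => ((Z ω).re, (Z ω).im)) = (volume : Measure (ℝ × ℝ)).withDensity
      (fun p => gaussianPDF 0 v p.1 * gaussianPDF 0 v p.2) := by
    rw [h.map_re_im, gaussianReal_of_var_ne_zero _ hv0,
      prod_withDensity (measurable_gaussianPDF 0 v) (measurable_gaussianPDF 0 v)]
    rfl
  have hdm : Measurable fun p : ℝ × ℝ => gaussianPDF 0 v p.1 * gaussianPDF 0 v p.2 := by fun_prop
  have hdt : ∀ᵐ p : ℝ × ℝ, gaussianPDF 0 v p.1 * gaussianPDF 0 v p.2 < ⊤ :=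
    .of_forall fun p => ENNReal.mul_lt_top gaussianPDF_lt_top gaussianPDF_lt_top
  have hdens : ∀ p : ℝ × ℝ, (gaussianPDF 0 v p.1 * gaussianPDF 0 v p.2).toReal =
      (Real.pi * s)⁻¹ * Real.exp (-((p.1 ^ 2 + p.2 ^ 2) / s)) := fun p => by
    rw [ENNReal.toReal_mul, toReal_gaussianPDF, toReal_gaussianPDF, gaussianPDFReal,
      gaussianPDFReal, hvs, show 2 * Real.pi * (s / 2) = Real.pi * s by ring, mul_mul_mul_comm,
      ← Real.exp_add, ← mul_inv, Real.mul_self_sqrt (by positivity)]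
    congr 2
    field_simp
    ring
  have hint2 : Integrable f (P.map fun ω => ((Z ω).re, (Z ω).im)) :=
    (integrable_map_measure hfm.aestronglyMeasurable hG.aemeasurable).2 hint
  rw [hmap, integrable_withDensity_iff_integrable_smul' hdm hdt] at hint2
  simp only [hdens, smul_eq_mul, mul_assoc] at hint2
  have hint3 := hint2.const_mul (Real.pi * s)
  have hps : Real.pi * s ≠ 0 := by positivity
  simp only [mul_inv_cancel_left₀ hps] at hint3
  have key := le_integral_exp_mul_log hs c hint3
  rw [← integral_map hG.aemeasurable hfm.aestronglyMeasurable, hmap,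
    integral_withDensity_eq_integral_toReal_smul hdm hdt]
  simp only [hdens, smul_eq_mul, mul_assoc]
  rw [integral_const_mul, inv_mul_eq_div, le_div_iff₀' (by positivity)]
  exact key

theorem const_mul (h : IsCircularGaussian P Z s) (c : ℂ) :
    IsCircularGaussian P (fun ω => c * Z ω) (‖c‖ ^ 2 * s) where
  gaussian := h.gaussian.map_fun ((ContinuousLinearMap.mul ℝ ℂ) c)
  mean := by rw [integral_const_mul, h.mean, mul_zero]
  variance := by simp only [norm_mul, mul_pow]; rw [integral_const_mul, h.variance]
  pseudo := by simp only [mul_mul_mul_comm]; rw [integral_const_mul, h.pseudo, mul_zero]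

end IsCircularGaussian

theorem isCircularGaussian_sum {Ω ι : Type*} [MeasurableSpace Ω] {P : Measure Ω} [Fintype ι]
    {Z : ι → Ω → ℂ} {s : ι → ℝ} (hZ : ∀ k, IsCircularGaussian P (Z k) (s k))
    (hind : iIndepFun Z P) :
    IsCircularGaussian P (fun ω => ∑ k, Z k ω) (∑ k, s k) where
  gaussian := iIndepFun.hasGaussianLaw_fun_sum (fun k => (hZ k).gaussian) hind
  mean := by
    rw [integral_finsetSum _ fun k _ => (hZ k).gaussian.integrable]
    simp [fun k => (hZ k).mean]
  variance := by
    classical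
    have hL := fun k => (hZ k).gaussian.memLp_two
    have hi : ∀ k l, Integrable (fun ω => Z k ω * star (Z l ω)) P := fun k l =>
      (hL k).integrable_mul (hL l).star
    have h0 : ∀ k l, ∫ ω, Z k ω * star (Z l ω) ∂P = if k = l then (s k : ℂ) else 0 := by
      intro k l
      split_ifs with hkl
      · subst hkl
        rw [← (hZ k).variance, ← integral_complex_ofReal]
        refine integral_congr_ae (.of_forall fun ω => ?_)
        simp [Complex.mul_conj']
      -- Distinct summands are independent and centred, so the cross terms vanish.
      · have := (hind.indepFun hkl).comp (φ := id) (ψ := star) measurable_id continuous_star.measurable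
        have h3 := this.integral_fun_mul_eq_mul_integral (hL k).1 (hL l).star.1
        simp only [Function.comp_def, id] at h3
        rw [h3, (hZ k).mean, zero_mul]
    rw [← Complex.ofReal_inj, ← integral_complex_ofReal]
    have : ∀ ω, ((‖∑ k, Z k ω‖ ^ 2 : ℝ) : ℂ) = ∑ k, ∑ l, Z k ω * star (Z l ω) := fun ω => by
      rw [← Finset.sum_mul_sum, ← star_sum, Complex.ofReal_pow, ← Complex.mul_conj']
      rfl
    simp only [this]
    rw [integral_finsetSum _ fun k _ => integrable_finsetSum _ fun l _ => hi k l]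
    simp only [integral_finsetSum _ fun l _ => hi _ l, h0]
    simp
  pseudo := by
    have hL := fun k => (hZ k).gaussian.memLp_two
    have hi : ∀ k l, Integrable (fun ω => Z k ω * Z l ω) P := fun k l =>
      (hL k).integrable_mul (hL l)
    have h0 : ∀ k l, ∫ ω, Z k ω * Z l ω ∂P = 0 := by
      intro k l
      by_cases hkl : k = l
      · rw [← hkl, (hZ k).pseudo]
      · rw [(hind.indepFun hkl).integral_fun_mul_eq_mul_integral (hL k).1 (hL l).1, (hZ k).mean,
          zero_mul]
    simp only [Finset.sum_mul_sum]
    rw [integral_finsetSum _ fun k _ => integrable_finsetSum _ fun l _ => hi k l]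
    simp [integral_finsetSum _ fun l _ => hi _ l, h0]

/-! ### Two consequences of the concavity of the logarithm -/

theorem sum_mul_log_one_add_div_le {ι : Type*} [Fintype ι] {p x : ι → ℝ} (hp : ∀ i, 0 ≤ p i)
    (hp1 : ∑ i, p i = 1) (hx : ∀ i, 0 ≤ x i) :
    ∑ i, p i * Real.log (1 + x i / p i) ≤ Real.log (1 + ∑ i, x i) := by
  have hpos : ∀ i, 0 < 1 + x i / p i := fun i => by
    have := div_nonneg (hx i) (hp i); linarith
  have h := strictConcaveOn_log_Ioi.concaveOn.le_map_sum (t := Finset.univ) (w := p)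
    (p := fun i => 1 + x i / p i) (fun i _ => hp i) hp1 (fun i _ => hpos i)
  simp only [smul_eq_mul] at h
  -- Only an inequality: where $p_i=0$, division by zero gives $0$ and $x_i$ is lost.
  have hle : ∑ i, p i * (1 + x i / p i) ≤ 1 + ∑ i, x i := by
    nth_rw 2 [← hp1]
    rw [← Finset.sum_add_distrib]
    refine Finset.sum_le_sum fun i _ => ?_
    rw [mul_add, mul_one]
    gcongr
    rcases (hp i).eq_or_lt with h0 | h0
    · rw [← h0, zero_mul]; exact hx i
    · rw [mul_div_cancel₀ _ h0.ne']
  have hge : (1 : ℝ) ≤ ∑ i, p i * (1 + x i / p i) := by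
    rw [← hp1]
    refine Finset.sum_le_sum fun i _ => ?_
    have := div_nonneg (hx i) (hp i)
    nlinarith [hp i]
  exact h.trans (Real.log_le_log (by linarith) hle)

/-- Jensen with weights $q_k=l_k/(t_kT)$ at the points $t_k/x_k$, followed by $\log y\ge1-1/y$. The
lower bound is affine in $x$, so integrating it needs only the means $t_k$ of the $x_k$. -/
theorem log_sum_div_add_le {ι : Type*} [Fintype ι] {l x t : ι → ℝ} (hl : ∀ k, 0 ≤ l k)
    (hx : ∀ k, 0 < x k) (ht : ∀ k, 0 < t k) (hT : 0 < ∑ k, l k / t k) :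
    Real.log (∑ k, l k / t k) + ∑ k, l k / t k / (∑ j, l j / t j) * (1 - x k / t k) ≤
      Real.log (∑ k, l k / x k) := by
  set T := ∑ k, l k / t k with hTdef
  have hq : ∀ k, 0 ≤ l k / t k / T := fun k => div_nonneg (div_nonneg (hl k) (ht k).le) hT.le
  have hq1 : ∑ k, l k / t k / T = 1 := by rw [← Finset.sum_div, ← hTdef, div_self hT.ne']
  have hy : ∀ k, 0 < t k / x k := fun k => div_pos (ht k) (hx k)
  have h := strictConcaveOn_log_Ioi.concaveOn.le_map_sum (t := Finset.univ)
    (w := fun k => l k / t k / T) (p := fun k => t k / x k) (fun k _ => hq k) hq1 (fun k _ => hy k)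
  simp only [smul_eq_mul] at h
  have hsum : ∑ k, l k / t k / T * (t k / x k) = (∑ k, l k / x k) / T := by
    rw [Finset.sum_div]
    refine Finset.sum_congr rfl fun k _ => ?_
    have := (ht k).ne'; have := (hx k).ne'
    field_simp
  have hpos : 0 < ∑ k, l k / x k := by
    obtain ⟨k, -, hk⟩ := Finset.exists_lt_of_sum_lt (s := Finset.univ) (f := fun _ : ι => (0 : ℝ))
      (g := fun k => l k / t k) (by simpa using hT)
    have hlk : 0 < l k := by
      rcases (hl k).eq_or_lt with h0 | h0
      · simp [← h0] at hk
      · exact h0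
    exact Finset.sum_pos' (fun j _ => div_nonneg (hl j) (hx j).le)
      ⟨k, Finset.mem_univ k, div_pos hlk (hx k)⟩
  rw [hsum, Real.log_div hpos.ne' hT.ne'] at h
  have h2 : ∑ k, l k / t k / T * (1 - x k / t k) ≤
      ∑ k, l k / t k / T * Real.log (t k / x k) := by
    refine Finset.sum_le_sum fun k _ => mul_le_mul_of_nonneg_left ?_ (hq k)
    have := Real.one_sub_inv_le_log_of_pos (hy k)
    rwa [inv_div] at this
  linarith

/-! ### Sums of squares of shifted Gaussians -/

section Gaussian

variable {Ω ι κ : Type*} [MeasurableSpace Ω] {P : Measure Ω} [Fintype ι] [Fintype κ]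
  {Z : κ → Ω → ℂ} {l : κ → ℝ}

theorem isCircularGaussian_linearCombination (hZ : ∀ k, IsCircularGaussian P (Z k) (l k))
    (hind : iIndepFun Z P) (u : κ → ℂ) :
    IsCircularGaussian P (fun ω => ∑ k, u k * Z k ω) (∑ k, ‖u k‖ ^ 2 * l k) :=
  isCircularGaussian_sum (fun k => (hZ k).const_mul (u k))
    (hind.comp (fun k z => u k * z) (fun k => measurable_const_mul (u k)))

theorem integrable_log_one_add_sum_sq {Y : ι → Ω → ℂ} {s : ι → ℝ} [IsProbabilityMeasure P]
    (hY : ∀ i, IsCircularGaussian P (Y i) (s i)) (c : ι → ℂ) :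
    Integrable (fun ω => Real.log (1 + ∑ i, ‖Y i ω + c i‖ ^ 2)) P := by
  have h2 : ∀ i, MemLp (fun ω => Y i ω + c i) 2 P := fun i =>
    (hY i).gaussian.memLp_two.add (memLp_const (c i))
  have hS : Integrable (fun ω => ∑ i, ‖Y i ω + c i‖ ^ 2) P :=
    integrable_finsetSum _ fun i _ => (h2 i).norm.integrable_sq
  refine hS.mono' ?_ (.of_forall fun ω => ?_)
  · have := hS.1.aemeasurable
    exact (by fun_prop : AEMeasurable _ P).aestronglyMeasurable
  · have h0 : 0 ≤ ∑ i, ‖Y i ω + c i‖ ^ 2 := by positivity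
    rw [Real.norm_of_nonneg (Real.log_nonneg (by linarith))]
    linarith [Real.log_le_sub_one_of_pos (x := 1 + ∑ i, ‖Y i ω + c i‖ ^ 2) (by positivity)]

/-- Jensen with weights $s_i/S$ splits the sum into coordinates, each rescaled to the same variance
$S$. The coordinates may be arbitrarily dependent, because only expectations are added. -/
theorem log_sub_le_integral_log_one_add_sum_sq {Y : ι → Ω → ℂ} {s : ι → ℝ}
    [IsProbabilityMeasure P] (hY : ∀ i, IsCircularGaussian P (Y i) (s i)) (c : ι → ℂ)
    (hs : ∀ i, 0 ≤ s i) (hS : 0 < ∑ i, s i) :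
    Real.log (∑ i, s i) - Real.eulerMascheroniConstant ≤
      ∫ ω, Real.log (1 + ∑ i, ‖Y i ω + c i‖ ^ 2) ∂P := by
  set S := ∑ i, s i with hSdef
  have hp : ∀ i, 0 ≤ s i / S := fun i => div_nonneg (hs i) hS.le
  have hp1 : ∑ i, s i / S = 1 := by rw [← Finset.sum_div, ← hSdef, div_self hS.ne']
  set r : ι → ℂ := fun i => ((Real.sqrt (s i / S))⁻¹ : ℝ) with hr
  have hrn : ∀ i, ‖r i‖ ^ 2 = (s i / S)⁻¹ := fun i => by
    rw [hr, Complex.norm_real, Real.norm_eq_abs, sq_abs, inv_pow, Real.sq_sqrt (hp i)]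
  have hg : ∀ i, IsCircularGaussian P (fun ω => r i * Y i ω) (‖r i‖ ^ 2 * s i) := fun i =>
    (hY i).const_mul (r i)
  have hx : ∀ i ω, ‖Y i ω + c i‖ ^ 2 / (s i / S) = ‖r i * Y i ω + r i * c i‖ ^ 2 := fun i ω => by
    rw [← mul_add, norm_mul, mul_pow, hrn, div_eq_inv_mul]
  have hlow : ∀ ω, ∑ i, s i / S * Real.log (1 + ‖r i * Y i ω + r i * c i‖ ^ 2) ≤
      Real.log (1 + ∑ i, ‖Y i ω + c i‖ ^ 2) := fun ω => by
    simp only [← hx]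
    exact sum_mul_log_one_add_div_le hp hp1 fun i => by positivity
  have hi : ∀ i, Integrable (fun ω => s i / S * Real.log (1 + ‖r i * Y i ω + r i * c i‖ ^ 2)) P :=
    fun i => ((hg i).integrable_log _).const_mul _
  calc Real.log S - Real.eulerMascheroniConstant
      = ∑ i, s i / S * (Real.log S - Real.eulerMascheroniConstant) := by
        rw [← Finset.sum_mul, hp1, one_mul]
    _ ≤ ∑ i, ∫ ω, s i / S * Real.log (1 + ‖r i * Y i ω + r i * c i‖ ^ 2) ∂P := by
      refine Finset.sum_le_sum fun i _ => ?_
      rw [integral_const_mul]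
      -- A degenerate coordinate has weight $0$; the scalar bound is needed only when $s_i>0$.
      rcases (hs i).eq_or_lt with h0 | h0
      · simp [← h0]
      · refine mul_le_mul_of_nonneg_left ?_ (hp i)
        have hv : ‖r i‖ ^ 2 * s i = S := by
          rw [hrn, inv_div, div_mul_cancel₀ _ h0.ne']
        have := (hg i).log_sub_le_integral_log (by rw [hv]; exact hS) (r i * c i)
        rwa [hv] at this
    _ = ∫ ω, ∑ i, s i / S * Real.log (1 + ‖r i * Y i ω + r i * c i‖ ^ 2) ∂P :=
      (integral_finsetSum _ fun i _ => hi i).symm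
    _ ≤ _ := integral_mono (integrable_finsetSum _ fun i _ => hi i)
      (integrable_log_one_add_sum_sq hY c) hlow

end Gaussian

/-! ### Linear algebra of the zero-forcing matrix -/

namespace RIS

section Algebra

variable {K NB NR : ℕ} {b : Fin NB → ℂ}

theorem conjTranspose_projPerp (b : Fin NB → ℂ) : (projPerp b)ᴴ = projPerp b := by
  simp [projPerp, conjTranspose_sub, conjTranspose_vecMulVec]

theorem projPerp_mul_self (hb : star b ⬝ᵥ b = 1) : projPerp b * projPerp b = projPerp b := by
  simp [projPerp, sub_mul, mul_sub, vecMulVec_mul_vecMulVec, hb]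

theorem conjTranspose_Cs (b : Fin NB → ℂ) (Hd : Matrix (Fin K) (Fin NB) ℂ) :
    (Cs b Hd)ᴴ = Cs b Hd := by
  simp [Cs, conjTranspose_mul, conjTranspose_projPerp, Matrix.mul_assoc]

/-- The right inverse `(I - b bᴴ) H_dᴴ C_s⁻¹` of `H_d`. -/
noncomputable def zeroForcing (b : Fin NB → ℂ) (Hd : Matrix (Fin K) (Fin NB) ℂ) : Matrix (Fin NB) (Fin K) ℂ :=
  projPerp b * Hdᴴ * (Cs b Hd)⁻¹

theorem mul_zeroForcing {Hd : Matrix (Fin K) (Fin NB) ℂ} (hC : IsUnit (Cs b Hd).det) :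
    Hd * zeroForcing b Hd = 1 := by
  rw [zeroForcing, ← Matrix.mul_assoc, ← Matrix.mul_assoc]
  exact mul_nonsing_inv _ hC

/-- Write $P=I-bb^H$, a Hermitian idempotent, so $PL=L$. Then
$L^HL=C_s^{-1}H_dPL=C_s^{-1}H_dL=C_s^{-1}$. -/
theorem conjTranspose_zeroForcing_mul_self (hb : star b ⬝ᵥ b = 1)
    {Hd : Matrix (Fin K) (Fin NB) ℂ} (hC : IsUnit (Cs b Hd).det) :
    (zeroForcing b Hd)ᴴ * zeroForcing b Hd = (Cs b Hd)⁻¹ := by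
  have h1 : (zeroForcing b Hd)ᴴ = (Cs b Hd)⁻¹ * (Hd * projPerp b) := by
    rw [zeroForcing, conjTranspose_mul, conjTranspose_mul, conjTranspose_conjTranspose,
      conjTranspose_projPerp, conjTranspose_nonsing_inv, conjTranspose_Cs]
  have h2 : projPerp b * zeroForcing b Hd = zeroForcing b Hd := by
    rw [zeroForcing, ← Matrix.mul_assoc, ← Matrix.mul_assoc, projPerp_mul_self hb]
  rw [h1, Matrix.mul_assoc, Matrix.mul_assoc, h2, mul_zeroForcing hC, Matrix.mul_one]

theorem mitigation_eq_sum (hb : star b ⬝ᵥ b = 1) {Hd : Matrix (Fin K) (Fin NB) ℂ}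
    (hC : IsUnit (Cs b Hd).det) (Hc : Matrix (Fin K) (Fin NR) ℂ) (θ : Fin NR → ℂ) :
    mitigation b Hd Hc θ = ∑ i, ‖(zeroForcing b Hd *ᵥ (Hc *ᵥ θ + Hd *ᵥ b)) i‖ ^ 2 := by
  have hD : Ds b Hd Hc *ᵥ thetaBar θ = Hc *ᵥ θ + Hd *ᵥ b := by
    rw [Ds, thetaBar, fromCols_mulVec_sumElim]
    congr 1
    ext k
    simp [mulVec, dotProduct]
  rw [mitigation, ← conjTranspose_zeroForcing_mul_self hb hC, ← hD]
  set D := Ds b Hd Hc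
  set x := thetaBar θ
  set L := zeroForcing b Hd
  have : Dᴴ * (Lᴴ * L) * D = (L * D)ᴴ * (L * D) := by
    rw [conjTranspose_mul]; simp only [Matrix.mul_assoc]
  rw [this, ← mulVec_mulVec, dotProduct_mulVec, vecMul_conjTranspose, star_star, mulVec_mulVec]
  simp only [dotProduct, Pi.star_apply, Complex.re_sum]
  refine Finset.sum_congr rfl fun i _ => ?_
  have := Complex.conj_mul' (((L * D) *ᵥ x) i)
  rw [show star (((L * D) *ᵥ x) i) = (starRingEnd ℂ) (((L * D) *ᵥ x) i) from rfl, this]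
  norm_cast

/-- Cauchy–Schwarz applied to the diagonal entry $(H_dL)_{kk}=1$. -/
theorem inv_sum_le_sum_zeroForcing {Hd : Matrix (Fin K) (Fin NB) ℂ}
    (hC : IsUnit (Cs b Hd).det) (k : Fin K) :
    0 < ∑ i, ‖Hd k i‖ ^ 2 ∧ (∑ i, ‖Hd k i‖ ^ 2)⁻¹ ≤ ∑ i, ‖zeroForcing b Hd i k‖ ^ 2 := by
  have h1 : ∑ i, Hd k i * zeroForcing b Hd i k = 1 := by
    rw [← mul_apply, mul_zeroForcing hC, one_apply_eq]
  have h2 : (1 : ℝ) ≤ ∑ i, ‖Hd k i‖ * ‖zeroForcing b Hd i k‖ := by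
    calc (1 : ℝ) = ‖∑ i, Hd k i * zeroForcing b Hd i k‖ := by rw [h1, norm_one]
      _ ≤ ∑ i, ‖Hd k i * zeroForcing b Hd i k‖ := norm_sum_le _ _
      _ = _ := by simp only [norm_mul]
  have h3 := Finset.sum_mul_sq_le_sq_mul_sq Finset.univ (fun i => ‖Hd k i‖)
    (fun i => ‖zeroForcing b Hd i k‖)
  have h4 : (1 : ℝ) ≤ (∑ i, ‖Hd k i‖ ^ 2) * ∑ i, ‖zeroForcing b Hd i k‖ ^ 2 := by
    nlinarith
  have h5 : 0 ≤ ∑ i, ‖Hd k i‖ ^ 2 := by positivity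
  have h6 : 0 < ∑ i, ‖Hd k i‖ ^ 2 := by
    rcases h5.eq_or_lt with h | h
    · rw [← h, zero_mul] at h4; linarith
    · exact h
  exact ⟨h6, by rwa [inv_le_iff_one_le_mul₀' h6]⟩

end Algebra

end RIS

/-! ### Gaussian channel vectors and measurability -/

namespace RIS

variable {Ω : Type*} [MeasurableSpace Ω] {P : Measure Ω} {K NB NR n : ℕ}

theorem cascaded_apply (LG : ℝ) (a x : Fin NR → ℂ) (i : Fin NR) :
    cascaded NB LG a x i = (Real.sqrt (LG * NB) : ℂ) * star (a i) * x i := by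
  simp [cascaded, vecMul_diagonal]
  ring

theorem IsComplexNormal.cascaded {X : Ω → Fin NR → ℂ} {R : Matrix (Fin NR) (Fin NR) ℂ}
    (h : IsComplexNormal P X R) {LG : ℝ} (hLG : 0 ≤ LG) (a : Fin NR → ℂ) :
    IsComplexNormal P (fun ω => RIS.cascaded NB LG a (X ω))
      (((LG * NB : ℝ) : ℂ) • (diagonal (star a) * R * diagonal a)) where
  gaussian := by
    have := h.gaussian.map_fun (ContinuousLinearMap.pi fun i : Fin NR =>
      (ContinuousLinearMap.mul ℝ ℂ ((Real.sqrt (LG * NB) : ℂ) * star (a i))).comp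
        (ContinuousLinearMap.proj (R := ℝ) (φ := fun _ : Fin NR => ℂ) i))
    refine this.congr (.of_forall fun ω => ?_)
    ext i
    exact (cascaded_apply LG a (X ω) i).symm
  mean i := by
    simp only [cascaded_apply]
    rw [integral_const_mul, h.mean, mul_zero]
  covariance := by
    ext i j
    have hs : (Real.sqrt (LG * NB) : ℂ) * Real.sqrt (LG * NB) = ((LG * NB : ℝ) : ℂ) := by
      rw [← Complex.ofReal_mul, Real.mul_self_sqrt (by positivity)]
    have e : ∀ ω, RIS.cascaded NB LG a (X ω) i * star (RIS.cascaded NB LG a (X ω) j) =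
        (((LG * NB : ℝ) : ℂ) * (star (a i) * a j)) * (X ω i * star (X ω j)) := fun ω => by
      rw [cascaded_apply, cascaded_apply, ← hs]
      simp
      ring
    simp only [secondMoment, of_apply, e, Matrix.smul_apply, mul_diagonal, diagonal_mul]
    rw [integral_const_mul, ← h.covariance]
    simp [secondMoment]
    ring
  pseudo i j := by
    have e : ∀ ω, RIS.cascaded NB LG a (X ω) i * RIS.cascaded NB LG a (X ω) j =
        ((Real.sqrt (LG * NB) : ℂ) * star (a i) * ((Real.sqrt (LG * NB) : ℂ) * star (a j))) *
          (X ω i * X ω j) := fun ω => by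
      rw [cascaded_apply, cascaded_apply]; ring
    simp only [e]
    rw [integral_const_mul, h.pseudo, mul_zero]

theorem IsComplexNormal.memLp_apply {X : Ω → Fin n → ℂ} {R : Matrix (Fin n) (Fin n) ℂ}
    (h : IsComplexNormal P X R) (i : Fin n) : MemLp (fun ω => X ω i) 2 P :=
  (HasGaussianLaw.eval (X := fun i ω => X ω i) h.gaussian i).memLp_two

/-- The map $x\mapsto x^Hu$ is only conjugate-linear, but real-linearity suffices for Gaussianity.
Expanding the squares reduces the other moments to those of $X$ and their conjugates. -/
theorem IsComplexNormal.star_dotProduct [IsProbabilityMeasure P] {X : Ω → Fin n → ℂ} {R : Matrix (Fin n) (Fin n) ℂ}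
    (h : IsComplexNormal P X R) (u : Fin n → ℂ) :
    IsCircularGaussian P (fun ω => star (X ω) ⬝ᵥ u) (star u ⬝ᵥ (R *ᵥ u)).re where
  gaussian := by
    have := h.gaussian.map_fun (∑ i : Fin n, (ContinuousLinearMap.mul ℝ ℂ (u i)).comp
      (Complex.conjCLE.toContinuousLinearMap.comp
        (ContinuousLinearMap.proj (R := ℝ) (φ := fun _ : Fin n => ℂ) i)))
    refine this.congr (.of_forall fun ω => ?_)
    simp [dotProduct, mul_comm]
  mean := by
    simp only [dotProduct]
    rw [integral_finsetSum _ fun i _ => ?_]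
    · refine Finset.sum_eq_zero fun i _ => ?_
      rw [integral_mul_const]
      have := integral_conj (μ := P) (f := fun ω => X ω i)
      simp only [h.mean, map_zero] at this
      simp [this]
    · exact ((h.memLp_apply i).star.integrable (by norm_num)).mul_const _
  variance := by
    have e : ∀ ω, ((‖star (X ω) ⬝ᵥ u‖ ^ 2 : ℝ) : ℂ) =
        ∑ i, ∑ j, (star (u i) * u j) * (X ω i * star (X ω j)) := fun ω => by
      rw [Complex.ofReal_pow, ← Complex.conj_mul', dotProduct, map_sum, Finset.sum_mul_sum]
      refine Finset.sum_congr rfl fun i _ => Finset.sum_congr rfl fun j _ => ?_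
      simp
      ring
    have hi : ∀ i j, Integrable (fun ω => (star (u i) * u j) * (X ω i * star (X ω j))) P :=
      fun i j => ((h.memLp_apply i).integrable_mul (h.memLp_apply j).star).const_mul _
    have key : ((∫ ω, ‖star (X ω) ⬝ᵥ u‖ ^ 2 ∂P : ℝ) : ℂ) = star u ⬝ᵥ (R *ᵥ u) := by
      rw [← integral_complex_ofReal]
      simp only [e]
      rw [integral_finsetSum _ fun i _ => integrable_finsetSum _ fun j _ => hi i j]
      simp only [integral_finsetSum _ fun j _ => hi _ j, integral_const_mul, dotProduct, mulVec,
        Finset.mul_sum, ← h.covariance, secondMoment, of_apply, Pi.star_apply]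
      refine Finset.sum_congr rfl fun i _ => Finset.sum_congr rfl fun j _ => ?_
      ring
    rw [← key, Complex.ofReal_re]
  pseudo := by
    have e : ∀ ω, (star (X ω) ⬝ᵥ u) * (star (X ω) ⬝ᵥ u) =
        ∑ i, ∑ j, (u i * u j) * star (X ω i * X ω j) := fun ω => by
      rw [dotProduct, Finset.sum_mul_sum]
      refine Finset.sum_congr rfl fun i _ => Finset.sum_congr rfl fun j _ => ?_
      simp
      ring
    have hi : ∀ i j, Integrable (fun ω => (u i * u j) * star (X ω i * X ω j)) P := fun i j => by
      simp only [star_mul']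
      exact ((h.memLp_apply i).star.integrable_mul (h.memLp_apply j).star).const_mul _
    simp only [e]
    rw [integral_finsetSum _ fun i _ => integrable_finsetSum _ fun j _ => hi i j]
    refine Finset.sum_eq_zero fun i _ => ?_
    rw [integral_finsetSum _ fun j _ => hi i j]
    refine Finset.sum_eq_zero fun j _ => ?_
    have := integral_conj (μ := P) (f := fun ω => X ω i * X ω j)
    rw [h.pseudo, map_zero] at this
    rw [integral_const_mul]
    exact mul_eq_zero_of_right _ this


theorem measurable_mul_apply {E : Type*} [MeasurableSpace E] {l m p : ℕ}
    {M : E → Matrix (Fin l) (Fin m) ℂ} {N : E → Matrix (Fin m) (Fin p) ℂ}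
    (hM : ∀ i j, Measurable fun x => M x i j) (hN : ∀ i j, Measurable fun x => N x i j)
    (i : Fin l) (j : Fin p) : Measurable fun x => (M x * N x) i j := by
  simp only [mul_apply]
  fun_prop

/-- The adjugate formula holds everywhere, singular matrices included, with inversion of the
determinant measurable also at $0$. -/
theorem measurable_inv_apply {E : Type*} [MeasurableSpace E] {l : ℕ}
    {M : E → Matrix (Fin l) (Fin l) ℂ} (hM : ∀ i j, Measurable fun x => M x i j)
    (i j : Fin l) : Measurable fun x => (M x)⁻¹ i j := by
  have h1 : Measurable fun x => (fun i j => M x i j : Fin l → Fin l → ℂ) := by fun_prop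
  have h2 : Measurable fun x => (M x).det := by
    have hc : Continuous fun m : Fin l → Fin l → ℂ => (Matrix.of m).det :=
      Continuous.matrix_det continuous_id
    exact hc.measurable.comp h1
  have h3 : Measurable fun x => (M x).adjugate i j := by
    have hc : Continuous fun m : Fin l → Fin l → ℂ => (Matrix.of m).adjugate i j :=
      (Continuous.matrix_adjugate continuous_id).matrix_elem i j
    exact hc.measurable.comp h1
  simp only [inv_def, Matrix.smul_apply, Ring.inverse_eq_inv', smul_eq_mul]
  exact h2.inv.mul h3

theorem measurable_mitigation (LG : ℝ) (a : Fin NR → ℂ) (b : Fin NB → ℂ) :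
    Measurable fun x : (Fin NR → ℂ) × (Fin K → Fin NR → ℂ) × (Fin K → Fin NB → ℂ) =>
      mitigation b (stack x.2.2) (stack fun k => cascaded NB LG a (x.2.1 k)) x.1 := by
  have hHd : ∀ i j, Measurable
      fun x : (Fin NR → ℂ) × (Fin K → Fin NR → ℂ) × (Fin K → Fin NB → ℂ) =>
        stack x.2.2 i j := fun i j => by
    simp only [stack, of_apply, Pi.star_apply]
    exact continuous_star.measurable.comp (by fun_prop)
  have hHc : ∀ i j, Measurable
      fun x : (Fin NR → ℂ) × (Fin K → Fin NR → ℂ) × (Fin K → Fin NB → ℂ) =>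
        stack (fun k => cascaded NB LG a (x.2.1 k)) i j := fun i j => by
    simp only [stack, of_apply, Pi.star_apply, cascaded_apply]
    exact continuous_star.measurable.comp (by fun_prop)
  have hCs : ∀ i j, Measurable
      fun x : (Fin NR → ℂ) × (Fin K → Fin NR → ℂ) × (Fin K → Fin NB → ℂ) =>
        Cs b (stack x.2.2) i j :=
    measurable_mul_apply (measurable_mul_apply hHd fun i j => measurable_const) fun i j => by
      simp only [conjTranspose_apply]
      exact continuous_star.measurable.comp (hHd j i)
  have hCi := measurable_inv_apply hCs
  have hV : ∀ i, Measurable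
      fun x : (Fin NR → ℂ) × (Fin K → Fin NR → ℂ) × (Fin K → Fin NB → ℂ) =>
        (Ds b (stack x.2.2) (stack fun k => cascaded NB LG a (x.2.1 k)) *ᵥ thetaBar x.1) i :=
    fun i => by
      simp only [Ds, thetaBar, fromCols_mulVec_sumElim]
      simp only [Pi.add_apply, mulVec, dotProduct, replicateCol_apply]
      fun_prop
  have e : ∀ x : (Fin NR → ℂ) × (Fin K → Fin NR → ℂ) × (Fin K → Fin NB → ℂ),
      mitigation b (stack x.2.2) (stack fun k => cascaded NB LG a (x.2.1 k)) x.1 =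
      (star (Ds b (stack x.2.2) (stack fun k => cascaded NB LG a (x.2.1 k)) *ᵥ thetaBar x.1) ⬝ᵥ
        ((Cs b (stack x.2.2))⁻¹ *ᵥ
          (Ds b (stack x.2.2) (stack fun k => cascaded NB LG a (x.2.1 k)) *ᵥ thetaBar x.1))).re :=
    fun x => by
      rw [mitigation, ← mulVec_mulVec, ← mulVec_mulVec, dotProduct_mulVec, vecMul_conjTranspose,
        star_star]
  simp only [e]
  refine Complex.measurable_re.comp ?_
  simp only [dotProduct, mulVec, Pi.star_apply] at hV ⊢
  refine Finset.measurable_sum _ fun i _ => (continuous_star.measurable.comp (hV i)).mul ?_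
  exact Finset.measurable_sum _ fun j _ => (hCi i j).mul (hV j)

end RIS

/-! ### Averaging over independent channels -/

/-- Fubini on the product law. The sectionwise bound may assume integrability of the section, which
holds almost surely. It is applied twice: to $H_d$ against the reflecting channels, and to $\theta$
against both. -/
theorem integral_le_integral_of_indepFun {Ω α β : Type*} [MeasurableSpace Ω] [MeasurableSpace α]
    [MeasurableSpace β] {P : Measure Ω} [IsProbabilityMeasure P] {X : Ω → α} {Y : Ω → β}
    (hX : AEMeasurable X P) (hY : AEMeasurable Y P) (hXY : IndepFun X Y P) {f : α × β → ℝ}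
    (hf : Measurable f) (hfi : Integrable (fun ω => f (X ω, Y ω)) P) {g : Ω → ℝ}
    (hg : Integrable g P)
    (hgf : ∀ᵐ ω ∂P, Integrable (fun ω' => f (X ω, Y ω')) P → g ω ≤ ∫ ω', f (X ω, Y ω') ∂P) :
    ∫ ω, g ω ∂P ≤ ∫ ω, f (X ω, Y ω) ∂P := by
  have hPX := Measure.isProbabilityMeasure_map (μ := P) hX
  have hPY := Measure.isProbabilityMeasure_map (μ := P) hY
  have hmap := (indepFun_iff_map_prod_eq_prod_map_map hX hY).1 hXY
  have hXYm : AEMeasurable (fun ω => (X ω, Y ω)) P := hX.prodMk hY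
  have hfp : Integrable f ((P.map X).prod (P.map Y)) := by
    rw [← hmap]; exact (integrable_map_measure hf.aestronglyMeasurable hXYm).2 hfi
  have hsec : ∀ x, Measurable fun y => f (x, y) := fun x => hf.comp measurable_prodMk_left
  have hφ : ∀ x, ∫ y, f (x, y) ∂(P.map Y) = ∫ ω', f (x, Y ω') ∂P := fun x =>
    integral_map hY (hsec x).aestronglyMeasurable
  have hφi := hfp.integral_prod_left
  rw [← integral_map hXYm hf.aestronglyMeasurable, hmap, integral_prod _ hfp,
    integral_map hX hφi.1]
  simp only [hφ] at hφi ⊢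
  refine integral_mono_ae hg ((integrable_map_measure hφi.1 hX).1 hφi) ?_
  filter_upwards [hgf, ae_of_ae_map hX hfp.prod_right_ae] with ω h1 h2
  exact h1 ((integrable_map_measure (hsec _).aestronglyMeasurable hY).1 h2)

theorem integral_add_sum_mul_one_sub_div_sub {Ω κ : Type*} [MeasurableSpace Ω] [Fintype κ]
    {P : Measure Ω} [IsProbabilityMeasure P] {x : κ → Ω → ℝ} {t : κ → ℝ}
    (hx : ∀ k, Integrable (x k) P) (hxt : ∀ k, ∫ ω, x k ω ∂P = t k) (ht : ∀ k, t k ≠ 0)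
    (q : κ → ℝ) (c e : ℝ) :
    Integrable (fun ω => c + ∑ k, q k * (1 - x k ω / t k) - e) P ∧
      ∫ ω, (c + ∑ k, q k * (1 - x k ω / t k) - e) ∂P = c - e := by
  have hi1 : ∀ k, Integrable (fun ω => 1 - x k ω / t k) P := fun k =>
    (integrable_const _).sub ((hx k).div_const _)
  have hi2 : Integrable (fun ω => ∑ k, q k * (1 - x k ω / t k)) P :=
    integrable_finsetSum _ fun k _ => (hi1 k).const_mul _
  have hi3 : Integrable (fun ω => c + ∑ k, q k * (1 - x k ω / t k)) P :=
    (integrable_const _).add hi2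
  have h0 : ∀ k, ∫ ω, (1 - x k ω / t k) ∂P = 0 := fun k => by
    rw [integral_sub (integrable_const _) ((hx k).div_const _), integral_div, hxt, div_self (ht k)]
    simp
  refine ⟨hi3.sub (integrable_const _), ?_⟩
  rw [integral_sub hi3 (integrable_const _), integral_add (integrable_const _) hi2,
    integral_finsetSum _ fun k _ => (hi1 k).const_mul _]
  simp [integral_const_mul, h0]

namespace RIS

variable {Ω : Type*} [MeasurableSpace Ω] {P : Measure Ω} {K NB NR n : ℕ}

theorem integrable_sum_norm_sq {X : Ω → Fin n → ℂ} (hX : MemLp X 2 P) :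
    Integrable (fun ω => ∑ i, ‖X ω i‖ ^ 2) P :=
  integrable_finsetSum _ fun i _ => (hX.eval i).norm.integrable_sq

theorem re_trace_secondMoment {X : Ω → Fin n → ℂ} (hX : MemLp X 2 P) :
    (secondMoment P X).trace.re = ∫ ω, ∑ i, ‖X ω i‖ ^ 2 ∂P := by
  rw [integral_finsetSum _ fun i _ => (hX.eval i).norm.integrable_sq, trace, Complex.re_sum]
  refine Finset.sum_congr rfl fun i _ => ?_
  have : ∀ ω, X ω i * star (X ω i) = ((‖X ω i‖ ^ 2 : ℝ) : ℂ) := fun ω => by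
    rw [Complex.ofReal_pow]; exact Complex.mul_conj' _
  simp only [diag_apply, secondMoment, of_apply, this]
  rw [integral_complex_ofReal, Complex.ofReal_re]

variable [IsProbabilityMeasure P] {b : Fin NB → ℂ}

theorem mitigation_nonneg (hb : star b ⬝ᵥ b = 1) {Hd : Matrix (Fin K) (Fin NB) ℂ}
    (hC : IsUnit (Cs b Hd).det) (Hc : Matrix (Fin K) (Fin NR) ℂ) (θ : Fin NR → ℂ) :
    0 ≤ mitigation b Hd Hc θ := by
  rw [mitigation_eq_sum hb hC]; positivity

theorem sum_norm_sq_pos {d : Fin K → Fin NB → ℂ} (hC : IsUnit (Cs b (stack d)).det) (k : Fin K) :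
    0 < ∑ i, ‖d k i‖ ^ 2 := by
  simpa [stack] using (inv_sum_le_sum_zeroForcing hC k).1

theorem re_trace_secondMoment_pos {hd : Ω → Fin K → Fin NB → ℂ}
    (hd_sq : ∀ k, MemLp (fun ω => hd ω k) 2 P)
    (hC : ∀ᵐ ω ∂P, IsUnit (Cs b (stack (hd ω))).det) (k : Fin K) :
    0 < (secondMoment P (fun ω => hd ω k)).trace.re := by
  rw [re_trace_secondMoment (hd_sq k)]
  have h0 : 0 ≤ ∫ ω, ∑ i, ‖hd ω k i‖ ^ 2 ∂P := integral_nonneg fun ω => by positivity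
  refine h0.lt_of_ne' fun h => ?_
  rw [integral_eq_zero_iff_of_nonneg (fun ω => by positivity) (integrable_sum_norm_sq (hd_sq k))]
    at h
  obtain ⟨ω, h1, h2⟩ := (h.and hC).exists
  exact (sum_norm_sq_pos h2 k).ne' h1

/-- The rate loss averaged over the reflecting channels, for fixed direct channels and phases. -/
theorem le_integral_log_one_add_mitigation (hb : star b ⬝ᵥ b = 1) {X : Ω → Fin K → Fin NR → ℂ}
    {Rc : Fin K → Matrix (Fin NR) (Fin NR) ℂ}
    (hX : ∀ k, IsComplexNormal P (fun ω => X ω k) (Rc k))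
    (hind : iIndepFun (fun k ω => X ω k) P) (θ : Fin NR → ℂ) {d : Fin K → Fin NB → ℂ}
    (hC : IsUnit (Cs b (stack d)).det) {t : Fin K → ℝ} (ht : ∀ k, 0 < t k)
    (hT : 0 < ∑ k, (star θ ⬝ᵥ (Rc k *ᵥ θ)).re / t k) :
    Real.log (∑ k, (star θ ⬝ᵥ (Rc k *ᵥ θ)).re / t k) +
        ∑ k, (star θ ⬝ᵥ (Rc k *ᵥ θ)).re / t k / (∑ j, (star θ ⬝ᵥ (Rc j *ᵥ θ)).re / t j) *
          (1 - (∑ i, ‖d k i‖ ^ 2) / t k) - Real.eulerMascheroniConstant ≤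
      ∫ ω, Real.log (1 + mitigation b (stack d) (stack (X ω)) θ) ∂P := by
  set l : Fin K → ℝ := fun k => (star θ ⬝ᵥ (Rc k *ᵥ θ)).re with hl
  have hZ : ∀ k, IsCircularGaussian P (fun ω => star (X ω k) ⬝ᵥ θ) (l k) := fun k =>
    (hX k).star_dotProduct θ
  have hl0 : ∀ k, 0 ≤ l k := fun k => by
    rw [← (hZ k).variance]; exact integral_nonneg fun ω => by positivity
  have hdot : Measurable fun x : Fin NR → ℂ => star x ⬝ᵥ θ := by
    simp only [dotProduct, Pi.star_apply]
    exact Finset.measurable_sum _ fun i _ =>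
      ((continuous_star (R := ℂ)).measurable.comp (measurable_pi_apply i)).mul_const (θ i)
  have hZind : iIndepFun (fun k ω => star (X ω k) ⬝ᵥ θ) P :=
    hind.comp (fun _ x => star x ⬝ᵥ θ) fun _ => hdot
  set L := zeroForcing b (stack d) with hL
  set c := L *ᵥ (stack d *ᵥ b) with hc
  -- The coordinates of $LH_c\theta$ have variances $\sum_k|L_{ik}|^2l_k$; the constant $c=LH_db$ is
  -- the shift.
  have hY := fun i => isCircularGaussian_linearCombination hZ hZind (L i)
  have hmit : ∀ ω, mitigation b (stack d) (stack (X ω)) θ =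
      ∑ i, ‖(∑ k, L i k * (star (X ω k) ⬝ᵥ θ)) + c i‖ ^ 2 := fun ω => by
    rw [mitigation_eq_sum hb hC, mulVec_add]
    rfl
  simp only [hmit]
  have hx : ∀ k, 0 < ∑ i, ‖d k i‖ ^ 2 := sum_norm_sq_pos hC
  have h1 := log_sum_div_add_le hl0 hx ht hT
  have hsum : ∑ k, l k / (∑ i, ‖d k i‖ ^ 2) ≤ ∑ i, ∑ k, ‖L i k‖ ^ 2 * l k := by
    rw [Finset.sum_comm]
    refine Finset.sum_le_sum fun k _ => ?_
    rw [← Finset.sum_mul, div_eq_inv_mul]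
    refine mul_le_mul_of_nonneg_right ?_ (hl0 k)
    simpa [stack, hL] using (inv_sum_le_sum_zeroForcing hC k).2
  have hpos : 0 < ∑ k, l k / (∑ i, ‖d k i‖ ^ 2) := by
    obtain ⟨k, -, hk⟩ := Finset.exists_lt_of_sum_lt (s := Finset.univ)
      (f := fun _ : Fin K => (0 : ℝ)) (g := fun k => l k / t k) (by simpa using hT)
    have hlk : 0 < l k := (div_pos_iff_of_pos_right (ht k)).1 hk
    exact Finset.sum_pos' (fun j _ => div_nonneg (hl0 j) (hx j).le)
      ⟨k, Finset.mem_univ k, div_pos hlk (hx k)⟩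
  have h2 := log_sub_le_integral_log_one_add_sum_sq hY c
    (fun i => Finset.sum_nonneg fun k _ => mul_nonneg (by positivity) (hl0 k))
    (hpos.trans_le hsum)
  have h3 := Real.log_le_log hpos hsum
  linarith

/-- The average rate loss, for fixed phases. -/
theorem log_sub_le_integral_log_one_add_mitigation (hb : star b ⬝ᵥ b = 1) {LG : ℝ}
    {a : Fin NR → ℂ} {hd : Ω → Fin K → Fin NB → ℂ} {hr : Ω → Fin K → Fin NR → ℂ}
    {Rc : Fin K → Matrix (Fin NR) (Fin NR) ℂ}
    (hX : ∀ k, IsComplexNormal P (fun ω => cascaded NB LG a (hr ω k)) (Rc k))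
    (hind : iIndepFun (fun k ω => cascaded NB LG a (hr ω k)) P)
    (hr_meas : AEMeasurable hr P) (hd_meas : AEMeasurable hd P)
    (hd_sq : ∀ k, MemLp (fun ω => hd ω k) 2 P) (hr_hd : IndepFun hr hd P)
    (hC : ∀ᵐ ω ∂P, IsUnit (Cs b (stack (hd ω))).det) (θ : Fin NR → ℂ)
    {t : Fin K → ℝ} (ht : ∀ k, (secondMoment P fun ω => hd ω k).trace.re = t k)
    (hT : 0 < ∑ k, (star θ ⬝ᵥ (Rc k *ᵥ θ)).re / t k)
    (hint : Integrable (fun ω => Real.log (1 + mitigation b (stack (hd ω))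
      (stack fun k => cascaded NB LG a (hr ω k)) θ)) P) :
    Real.log (∑ k, (star θ ⬝ᵥ (Rc k *ᵥ θ)).re / t k) - Real.eulerMascheroniConstant ≤
      ∫ ω, Real.log (1 + mitigation b (stack (hd ω))
        (stack fun k => cascaded NB LG a (hr ω k)) θ) ∂P := by
  have htpos : ∀ k, 0 < t k := fun k => ht k ▸ re_trace_secondMoment_pos hd_sq hC k
  obtain ⟨hGi, hGint⟩ := integral_add_sum_mul_one_sub_div_sub
    (fun k => integrable_sum_norm_sq (hd_sq k)) (fun k => (re_trace_secondMoment (hd_sq k)).symm.trans (ht k))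
    (fun k => (htpos k).ne') (fun k => (star θ ⬝ᵥ (Rc k *ᵥ θ)).re / t k /
      ∑ j, (star θ ⬝ᵥ (Rc j *ᵥ θ)).re / t j) (Real.log (∑ k, (star θ ⬝ᵥ (Rc k *ᵥ θ)).re / t k))
    Real.eulerMascheroniConstant
  -- The constant is rewritten as the mean of the affine lower bound, whose fluctuation in
  -- $\|h_{d,k}\|^2$ is centred; the comparison can then be made for each value of $H_d$.
  rw [← hGint]
  have hm : Measurable fun x : (Fin K → Fin NB → ℂ) × (Fin K → Fin NR → ℂ) => (θ, x.2, x.1) := by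
    fun_prop
  have hf : Measurable fun x : (Fin K → Fin NB → ℂ) × (Fin K → Fin NR → ℂ) =>
      Real.log (1 + mitigation b (stack x.1) (stack fun k => cascaded NB LG a (x.2 k)) θ) :=
    Real.measurable_log.comp (((measurable_mitigation LG a b).comp hm).const_add 1)
  refine integral_le_integral_of_indepFun hd_meas hr_meas hr_hd.symm hf hint hGi ?_
  filter_upwards [hC] with ω hω _
  exact le_integral_log_one_add_mitigation hb hX hind θ hω htpos hT

theorem integral_log_sub_le_integral_log_one_add_mitigation (hb : star b ⬝ᵥ b = 1) {LG : ℝ}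
    {a : Fin NR → ℂ} {hd : Ω → Fin K → Fin NB → ℂ} {hr : Ω → Fin K → Fin NR → ℂ}
    {θ : Ω → Fin NR → ℂ} {Rc : Fin K → Matrix (Fin NR) (Fin NR) ℂ}
    (hX : ∀ k, IsComplexNormal P (fun ω => cascaded NB LG a (hr ω k)) (Rc k))
    (hind : iIndepFun (fun k ω => cascaded NB LG a (hr ω k)) P)
    (hr_meas : AEMeasurable hr P) (hd_meas : AEMeasurable hd P) (θ_meas : AEMeasurable θ P)
    (hd_sq : ∀ k, MemLp (fun ω => hd ω k) 2 P) (hr_hd : IndepFun hr hd P)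
    (θ_indep : IndepFun θ (fun ω => (hr ω, hd ω)) P)
    (hC : ∀ᵐ ω ∂P, IsUnit (Cs b (stack (hd ω))).det)
    {t : Fin K → ℝ} (ht : ∀ k, (secondMoment P fun ω => hd ω k).trace.re = t k)
    (hT : ∀ᵐ ω ∂P, 0 < ∑ k, (star (θ ω) ⬝ᵥ (Rc k *ᵥ θ ω)).re / t k)
    (hint : Integrable (fun ω => Real.log (1 + mitigation b (stack (hd ω))
      (stack fun k => cascaded NB LG a (hr ω k)) (θ ω))) P)
    (hVint : Integrable (fun ω => Real.log (∑ k, (star (θ ω) ⬝ᵥ (Rc k *ᵥ θ ω)).re / t k) - Real.eulerMascheroniConstant) P) :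
    ∫ ω, (Real.log (∑ k, (star (θ ω) ⬝ᵥ (Rc k *ᵥ θ ω)).re / t k) - Real.eulerMascheroniConstant) ∂P ≤
      ∫ ω, Real.log (1 + mitigation b (stack (hd ω))
        (stack fun k => cascaded NB LG a (hr ω k)) (θ ω)) ∂P := by
  have hf : Measurable fun x : (Fin NR → ℂ) × (Fin K → Fin NR → ℂ) × (Fin K → Fin NB → ℂ) =>
      Real.log (1 + mitigation b (stack x.2.2) (stack fun k => cascaded NB LG a (x.2.1 k)) x.1) :=
    Real.measurable_log.comp (measurable_const.add (measurable_mitigation LG a b))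
  refine integral_le_integral_of_indepFun θ_meas (hr_meas.prodMk hd_meas) θ_indep hf hint hVint ?_
  filter_upwards [hT] with ω hω hi
  exact log_sub_le_integral_log_one_add_mitigation hb hX hind hr_meas hd_meas hd_sq hr_hd hC _ ht hω hi

end RIS

/-! ### Extended-real expectations -/

namespace RIS

theorem expectation_congr {Ω : Type*} [MeasurableSpace Ω] {P : Measure Ω} {X Y : Ω → EReal}
    (h : X =ᵐ[P] Y) : expectation P X = expectation P Y := by
  have h1 : ∫⁻ ω, (X ω).toENNReal ∂P = ∫⁻ ω, (Y ω).toENNReal ∂P :=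
    lintegral_congr_ae (h.mono fun ω hω => by simp only [hω])
  have h2 : ∫⁻ ω, (-X ω).toENNReal ∂P = ∫⁻ ω, (-Y ω).toENNReal ∂P :=
    lintegral_congr_ae (h.mono fun ω hω => by simp only [hω])
  rw [expectation, expectation, h1, h2]

theorem toENNReal_neg_coe (x : ℝ) : (-(x : EReal)).toENNReal = ENNReal.ofReal (-x) := by
  rw [← EReal.coe_neg, EReal.real_coe_toENNReal]

/-- Comparison of the expectations of `(A - W) / c` and `(A - V) / c` when `A` need not be
integrable. -/
theorem expectation_sub_div_le {Ω : Type*} [MeasurableSpace Ω] {P : Measure Ω}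
    [IsProbabilityMeasure P] {A V W : Ω → ℝ} {c B : ℝ} (hc : 0 < c)
    (hA : AEMeasurable A P) (hV : AEMeasurable V P) (hW : AEMeasurable W P)
    (hW0 : ∀ᵐ ω ∂P, 0 ≤ W ω) (hVB : ∀ᵐ ω ∂P, V ω ≤ B)
    (hfin : ∫⁻ ω, ENNReal.ofReal ((A ω - V ω) / c) ∂P ≠ ⊤)
    (hVW : Integrable V P → Integrable W P → ∫ ω, V ω ∂P ≤ ∫ ω, W ω ∂P) :
    ∫⁻ ω, ENNReal.ofReal ((A ω - W ω) / c) ∂P ≠ ⊤ ∧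
    expectation P (fun ω => (((A ω - W ω) / c : ℝ) : EReal)) ≤
      expectation P (fun ω => (((A ω - V ω) / c : ℝ) : EReal)) := by
  have hpos : ∫⁻ ω, ENNReal.ofReal ((A ω - W ω) / c) ∂P ≠ ⊤ := by
    -- From $W\ge0$ and $V\le B$: $A-W\le A\le(A-V)+B$.
    refine ne_top_of_le_ne_top (b := ∫⁻ ω, (ENNReal.ofReal ((A ω - V ω) / c) +
      ENNReal.ofReal (B / c)) ∂P) ?_ (lintegral_mono_ae ?_)
    · rw [lintegral_add_right _ measurable_const]
      simp [hfin]
    · filter_upwards [hW0, hVB] with ω h1 h2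
      refine le_trans (ENNReal.ofReal_le_ofReal ?_) ENNReal.ofReal_add_le
      rw [← add_div]
      gcongr
      linarith
  refine ⟨hpos, ?_⟩
  -- If the negative part is infinite, the left expectation is $-\infty$; otherwise $A$, $V$ and $W$
  -- all turn out to be integrable.
  by_cases hneg : ∫⁻ ω, ENNReal.ofReal (-((A ω - W ω) / c)) ∂P = ⊤
  · simp only [expectation, EReal.real_coe_toENNReal, toENNReal_neg_coe, hneg]
    rw [EReal.coe_ennreal_top, EReal.sub_top]
    exact bot_le
  have hu : Integrable (fun ω => max ((A ω - V ω) / c) 0) P := by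
    have hm : AEMeasurable (fun ω => max ((A ω - V ω) / c) 0) P :=
      ((hA.sub hV).div_const c).max aemeasurable_const
    refine (lintegral_ofReal_ne_top_iff_integrable hm.aestronglyMeasurable
      (.of_forall fun ω => le_max_right _ _)).1 ?_
    simpa [ENNReal.ofReal_max] using hfin
  have hsp : Integrable (fun ω => max ((A ω - W ω) / c) 0) P := by
    have hm : AEMeasurable (fun ω => max ((A ω - W ω) / c) 0) P :=
      ((hA.sub hW).div_const c).max aemeasurable_const
    refine (lintegral_ofReal_ne_top_iff_integrable hm.aestronglyMeasurable
      (.of_forall fun ω => le_max_right _ _)).1 ?_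
    simpa [ENNReal.ofReal_max] using hpos
  have hsn : Integrable (fun ω => max (-((A ω - W ω) / c)) 0) P := by
    have hm : AEMeasurable (fun ω => max (-((A ω - W ω) / c)) 0) P :=
      ((hA.sub hW).div_const c).neg.max aemeasurable_const
    refine (lintegral_ofReal_ne_top_iff_integrable hm.aestronglyMeasurable
      (.of_forall fun ω => le_max_right _ _)).1 ?_
    simpa [ENNReal.ofReal_max] using hneg
  have hs : Integrable (fun ω => (A ω - W ω) / c) P := by
    refine (hsp.sub hsn).congr (.of_forall fun ω => ?_)
    simp only [Pi.sub_apply]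
    rcases le_total 0 ((A ω - W ω) / c) with h | h
    · rw [max_eq_left h, max_eq_right (by linarith), sub_zero]
    · rw [max_eq_right h, max_eq_left (by linarith)]; ring
  have hAW : Integrable (fun ω => A ω - W ω) P :=
    (hs.const_mul c).congr (.of_forall fun ω => by simp only; field_simp)
  have hcu : ∀ ω, A ω - V ω ≤ c * max ((A ω - V ω) / c) 0 := fun ω => by
    calc A ω - V ω = c * ((A ω - V ω) / c) := by field_simp
      _ ≤ _ := by gcongr; exact le_max_left _ _
  -- $A$ lies between the integrable functions $A-W$ and $(A-V)^++B$.
  have hAi : Integrable A P := by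
    refine Integrable.mono' ((hAW.norm.add (hu.const_mul c)).add (integrable_const |B|))
      hA.aestronglyMeasurable ?_
    filter_upwards [hW0, hVB] with ω h1 h2
    have h3 : 0 ≤ c * max ((A ω - V ω) / c) 0 := mul_nonneg hc.le (le_max_right _ _)
    have h4 := neg_abs_le (A ω - W ω)
    have h5 := le_abs_self B
    have h6 := abs_nonneg (A ω - W ω)
    have h7 := hcu ω
    have h8 := abs_nonneg B
    simp only [Pi.add_apply, Real.norm_eq_abs]
    exact abs_le.2 ⟨by linarith, by linarith⟩
  have hWi : Integrable W P := (hAi.sub hAW).congr (.of_forall fun ω => by simp)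
  -- $V$ lies between $A-(A-V)^+$ and $B$.
  have hVi : Integrable V P := by
    refine Integrable.mono' ((hAi.norm.add (hu.const_mul c)).add (integrable_const |B|))
      hV.aestronglyMeasurable ?_
    filter_upwards [hVB] with ω h2
    have h3 : 0 ≤ c * max ((A ω - V ω) / c) 0 := mul_nonneg hc.le (le_max_right _ _)
    have h4 := neg_abs_le (A ω)
    have h5 := le_abs_self B
    have h6 := abs_nonneg (A ω)
    have h7 := hcu ω
    have h8 := abs_nonneg B
    simp only [Pi.add_apply, Real.norm_eq_abs]
    exact abs_le.2 ⟨by linarith, by linarith⟩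
  rw [expectation_coe hs, expectation_coe (f := fun ω => (A ω - V ω) / c)
    ((hAi.sub hVi).div_const c)]
  refine EReal.coe_le_coe_iff.2 ?_
  rw [integral_div, integral_div, integral_sub hAi hWi, integral_sub hAi hVi]
  have := hVW hVi hWi
  gcongr

theorem elog2_div {N D : ℝ} (hN : 0 < N) (hD : 0 < D) :
    elog2 (ENNReal.ofReal N / ENNReal.ofReal D) =
      (((Real.log N - Real.log D) / Real.log 2 : ℝ) : EReal) := by
  rw [← ENNReal.ofReal_div_of_pos hD, elog2_ofReal (div_pos hN hD), Real.logb,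
    Real.log_div hN.ne' hD.ne']

theorem elog2_div_zero {N : ℝ} (hN : 0 < N) : elog2 (ENNReal.ofReal N / 0) = ⊤ := by
  rw [ENNReal.div_zero (ENNReal.ofReal_pos.2 hN).ne', elog2, ENNReal.log_top]
  exact EReal.top_div_of_pos_ne_top (EReal.coe_pos.2 (Real.log_pos one_lt_two))
    (EReal.coe_ne_top _)

theorem re_star_dotProduct_mulVec_le {n : ℕ} (R : Matrix (Fin n) (Fin n) ℂ) {θ : Fin n → ℂ}
    (hθ : ∀ i, ‖θ i‖ = 1) : (star θ ⬝ᵥ (R *ᵥ θ)).re ≤ ∑ i, ∑ j, ‖R i j‖ := by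
  simp only [dotProduct, mulVec]
  refine (Complex.re_le_norm _).trans ((norm_sum_le _ _).trans (Finset.sum_le_sum fun i _ => ?_))
  rw [norm_mul, Pi.star_apply, norm_star (E := ℂ), hθ, one_mul]
  refine (norm_sum_le _ _).trans (Finset.sum_le_sum fun j _ => ?_)
  rw [norm_mul, hθ, mul_one]

theorem measurable_re_star_dotProduct_mulVec {n : ℕ} (R : Matrix (Fin n) (Fin n) ℂ) :
    Measurable fun θ : Fin n → ℂ => (star θ ⬝ᵥ (R *ᵥ θ)).re :=
  (by fun_prop : Continuous fun θ : Fin n → ℂ => (star θ ⬝ᵥ (R *ᵥ θ)).re).measurable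

theorem measurable_cascaded {NB NR : ℕ} (LG : ℝ) (a : Fin NR → ℂ) :
    Measurable fun x : Fin NR → ℂ => cascaded NB LG a x :=
  measurable_pi_lambda _ fun i => by simp only [cascaded_apply]; fun_prop

theorem aemeasurable_norm_star_dotProduct_sq {Ω : Type*} [MeasurableSpace Ω] {P : Measure Ω}
    {n : ℕ} {x y : Ω → Fin n → ℂ} (hx : AEMeasurable x P) (hy : AEMeasurable y P) :
    AEMeasurable (fun ω => ‖star (x ω) ⬝ᵥ y ω‖ ^ 2) P := by
  have hx' : ∀ i, AEMeasurable (fun ω => star (x ω i)) P := fun i =>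
    (continuous_star (R := ℂ)).measurable.comp_aemeasurable (hx.eval i)
  have hy' : ∀ i, AEMeasurable (fun ω => y ω i) P := fun i => hy.eval i
  simp only [dotProduct, Pi.star_apply]
  exact (Finset.aemeasurable_fun_sum _ fun i _ => (hx' i).mul (hy' i)).norm.pow_const 2

theorem aemeasurable_mitigation {Ω : Type*} [MeasurableSpace Ω] {P : Measure Ω} {K NB NR : ℕ}
    (LG : ℝ) (a : Fin NR → ℂ) (b : Fin NB → ℂ) {hd : Ω → Fin K → Fin NB → ℂ}
    {hr : Ω → Fin K → Fin NR → ℂ} {θ : Ω → Fin NR → ℂ} (hd_meas : AEMeasurable hd P)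
    (hr_meas : AEMeasurable hr P) (θ_meas : AEMeasurable θ P) :
    AEMeasurable (fun ω => mitigation b (stack (hd ω))
      (stack fun k => cascaded NB LG a (hr ω k)) (θ ω)) P := by
  have hx : AEMeasurable (fun ω => (θ ω, hr ω, hd ω)) P := θ_meas.prodMk (hr_meas.prodMk hd_meas)
  have hg := (measurable_mitigation (K := K) LG a b).comp_aemeasurable hx
  exact hg

end RIS

/-! ### Assembly -/

theorem theorem2 {Ω : Type*} [MeasurableSpace Ω] (P : Measure Ω) [IsProbabilityMeasure P]
    {K NB NR : ℕ} (LG pbar : ℝ) (hLG : 0 < LG) (hpbar : 0 < pbar)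
    -- the steering vectors of the rank-one channel from the base station to the surface
    (a : Fin NR → ℂ) (ha : star a ⬝ᵥ a = (NR : ℂ))
    (b : Fin NB → ℂ) (hb : star b ⬝ᵥ b = 1)
    -- direct and reflecting channels of the strong users, reflecting channel of the weak user,
    -- and phase shifts
    (hd : Ω → Fin K → Fin NB → ℂ) (hr : Ω → Fin K → Fin NR → ℂ)
    (hw : Ω → Fin NR → ℂ) (θ : Ω → Fin NR → ℂ)
    (hw_meas : AEMeasurable hw P) (θ_meas : AEMeasurable θ P)
    (θ_unit : ∀ᵐ ω ∂P, ∀ n, ‖θ ω n‖ = 1)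
    -- the direct channels have an arbitrary joint distribution with finite second moments
    (hd_sq : ∀ k, MemLp (fun ω => hd ω k) 2 P)
    -- independent Rayleigh fading for the strong users
    (Rr : Fin K → Matrix (Fin NR) (Fin NR) ℂ)
    (hr_normal : ∀ k, RIS.IsComplexNormal P (fun ω => hr ω k) (Rr k))
    (hr_indep : iIndepFun (fun k ω => hr ω k) P)
    (hr_hd_indep : IndepFun hr hd P)
    -- the phases are independent of the strong users' channels
    (θ_indep : IndepFun θ (fun ω => (hr ω, hd ω)) P)
    -- the quantities in the rate are well defined
    (Cs_inv : ∀ᵐ ω ∂P, IsUnit (RIS.Cs b (RIS.stack (hd ω))).det)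
    (hw_ne : ∀ᵐ ω ∂P, star (RIS.cascaded NB LG a (hw ω)) ⬝ᵥ θ ω ≠ 0)
    -- the second-moment matrices, the rate, and the bound
    (Rd : Fin K → Matrix (Fin NB) (Fin NB) ℂ)
    (hRd : ∀ k, Rd k = RIS.secondMoment P (fun ω => hd ω k))
    (Rc : Fin K → Matrix (Fin NR) (Fin NR) ℂ)
    (hRc : ∀ k, Rc k = RIS.secondMoment P (fun ω => RIS.cascaded NB LG a (hr ω k)))
    (SE : Ω → ℝ)
    (hSE : ∀ ω, SE ω = RIS.rateLinR pbar b (RIS.stack (hd ω))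
      (RIS.stack fun k => RIS.cascaded NB LG a (hr ω k)) (RIS.cascaded NB LG a (hw ω)) (θ ω))
    (U : Ω → EReal)
    (hU : ∀ ω, U ω = RIS.rateBound pbar Rc Rd (RIS.cascaded NB LG a (hw ω)) (θ ω))
    (U_exists : RIS.ExpectationExists P U) :
    (∀ k, Rc k = ((LG * NB : ℝ) : ℂ) • (diagonal (star a) * Rr k * diagonal a)) ∧
    (RIS.expectation P U ≠ ⊤ → RIS.ExpectationExists P (fun ω => (SE ω : EReal))) ∧
    RIS.expectation P (fun ω => (SE ω : EReal)) ≤ RIS.expectation P U := by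
  have hX : ∀ k, RIS.IsComplexNormal P (fun ω => RIS.cascaded NB LG a (hr ω k))
      (((LG * NB : ℝ) : ℂ) • (diagonal (star a) * Rr k * diagonal a)) := fun k =>
    (hr_normal k).cascaded hLG.le a
  have hRc' : ∀ k, Rc k = ((LG * NB : ℝ) : ℂ) • (diagonal (star a) * Rr k * diagonal a) :=
    fun k => (hRc k).trans (hX k).covariance
  refine ⟨hRc', ?_⟩
  -- Here the existence of the expectation makes the right-hand side $+\infty$, and nothing remains
  -- to be shown.
  by_cases hUp : ∫⁻ ω, (U ω).toENNReal ∂P = ⊤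
  · have hUn := U_exists.resolve_left (not_not.2 hUp)
    have hE : RIS.expectation P U = ⊤ := by
      rw [RIS.expectation, hUp, ← EReal.coe_ennreal_toReal hUn]
      rfl
    exact ⟨fun h => absurd hE h, hE ▸ le_top⟩
  simp only [← hRc'] at hX
  have hind : iIndepFun (fun k ω => RIS.cascaded NB LG a (hr ω k)) P :=
    hr_indep.comp (fun _ x => RIS.cascaded NB LG a x) fun _ => RIS.measurable_cascaded LG a
  have hr_meas : AEMeasurable hr P :=
    aemeasurable_pi_lambda _ fun k => (hr_normal k).gaussian.aemeasurable
  have hd_meas : AEMeasurable hd P := aemeasurable_pi_lambda _ fun k => (hd_sq k).1.aemeasurable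
  have htpos : ∀ k, 0 < (Rd k).trace.re := fun k =>
    hRd k ▸ RIS.re_trace_secondMoment_pos hd_sq Cs_inv k
  have hl0 : ∀ (θ : Fin NR → ℂ) k, 0 ≤ (star θ ⬝ᵥ (Rc k *ᵥ θ)).re := fun θ k => by
    rw [← ((hX k).star_dotProduct θ).variance]; exact integral_nonneg fun ω => by positivity
  set T : Ω → ℝ := fun ω => ∑ k, (star (θ ω) ⬝ᵥ (Rc k *ᵥ θ ω)).re / (Rd k).trace.re with hT
  have hT0 : ∀ ω, 0 ≤ T ω := fun ω =>
    Finset.sum_nonneg fun k _ => div_nonneg (hl0 _ k) (htpos k).le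
  set N : Ω → ℝ := fun ω => ‖star (RIS.cascaded NB LG a (hw ω)) ⬝ᵥ θ ω‖ ^ 2 * pbar with hN
  have hNpos : ∀ᵐ ω ∂P, 0 < N ω := hw_ne.mono fun ω h => by
    have := norm_pos_iff.2 h
    positivity
  have hTm : AEMeasurable T P :=
    (Finset.measurable_sum Finset.univ fun k _ =>
      (RIS.measurable_re_star_dotProduct_mulVec (Rc k)).div_const _).comp_aemeasurable θ_meas
  have hNm : AEMeasurable N P := by
    have hcw : AEMeasurable (fun ω => RIS.cascaded NB LG a (hw ω)) P :=
      (RIS.measurable_cascaded LG a).comp_aemeasurable hw_meas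
    exact (RIS.aemeasurable_norm_star_dotProduct_sq hcw θ_meas).mul_const pbar
  -- Almost surely $U=+\infty$ wherever $T=0$, so a finite positive part of $U$ makes that event
  -- null.
  have hTpos : ∀ᵐ ω ∂P, 0 < T ω := by
    have hm : AEMeasurable (fun ω => if T ω ≤ 0 then (⊤ : ℝ≥0∞) else 0) P :=
      (Measurable.ite measurableSet_Iic measurable_const measurable_const :
        Measurable fun x : ℝ => if x ≤ 0 then (⊤ : ℝ≥0∞) else 0).comp_aemeasurable hTm
    have hle : ∫⁻ ω, (if T ω ≤ 0 then (⊤ : ℝ≥0∞) else 0) ∂P ≤ ∫⁻ ω, (U ω).toENNReal ∂P := by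
      refine lintegral_mono_ae (hNpos.mono fun ω hω => ?_)
      split_ifs with h
      · have hz : T ω = 0 := le_antisymm h (hT0 ω)
        have : U ω = ⊤ := by
          rw [hU, RIS.rateBound]
          change RIS.elog2 (ENNReal.ofReal (N ω) / ENNReal.ofReal (_ * T ω)) = ⊤
          rw [hz, mul_zero, ENNReal.ofReal_zero, RIS.elog2_div_zero hω]
        rw [this, EReal.toENNReal_top]
      · exact zero_le
    refine (ae_lt_top' hm (ne_top_of_le_ne_top hUp hle)).mono fun ω h => ?_
    by_contra hn
    rw [if_pos (not_lt.1 hn)] at h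
    exact lt_irrefl _ h
  set m : Ω → ℝ := fun ω => RIS.mitigation b (RIS.stack (hd ω))
    (RIS.stack fun k => RIS.cascaded NB LG a (hr ω k)) (θ ω) with hm
  have hm0 : ∀ᵐ ω ∂P, 0 ≤ m ω := Cs_inv.mono fun ω h => RIS.mitigation_nonneg hb h _ _
  have hmm : AEMeasurable m P := RIS.aemeasurable_mitigation LG a b hd_meas hr_meas θ_meas
  have hUe : U =ᵐ[P] fun ω => (((Real.log (N ω) -
      (Real.log (T ω) - Real.eulerMascheroniConstant)) / Real.log 2 : ℝ) : EReal) := by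
    filter_upwards [hNpos, hTpos] with ω h1 h2
    rw [hU, RIS.rateBound]
    change RIS.elog2 (ENNReal.ofReal (N ω) / ENNReal.ofReal (_ * T ω)) = _
    rw [RIS.elog2_div h1 (mul_pos (Real.exp_pos _) h2),
      Real.log_mul (Real.exp_pos _).ne' h2.ne', Real.log_exp, neg_add_eq_sub]
  have hSEe : (fun ω => (SE ω : EReal)) =ᵐ[P] fun ω => (((Real.log (N ω) -
      Real.log (1 + m ω)) / Real.log 2 : ℝ) : EReal) := by
    filter_upwards [hNpos, hm0] with ω h1 h2
    rw [hSE, RIS.rateLinR]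
    change ((Real.logb 2 (N ω / (1 + m ω)) : ℝ) : EReal) = _
    rw [Real.logb, Real.log_div h1.ne' (by linarith)]
  have hfin : ∫⁻ ω, ENNReal.ofReal ((Real.log (N ω) -
      (Real.log (T ω) - Real.eulerMascheroniConstant)) / Real.log 2) ∂P ≠ ⊤ := by
    rwa [lintegral_congr_ae (hUe.mono fun ω hω => by rw [hω, EReal.real_coe_toENNReal])] at hUp
  -- Unit-modulus phases bound each quadratic form by the entrywise $\ell^1$ norm of $R_{c,k}$, and
  -- $\log T\le T-1$.
  have hVB : ∀ᵐ ω ∂P, Real.log (T ω) - Real.eulerMascheroniConstant ≤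
      ∑ k, (∑ i, ∑ j, ‖Rc k i j‖) / (Rd k).trace.re := by
    filter_upwards [θ_unit, hTpos] with ω h1 h2
    have h3 : T ω ≤ ∑ k, (∑ i, ∑ j, ‖Rc k i j‖) / (Rd k).trace.re :=
      Finset.sum_le_sum fun k _ => div_le_div_of_nonneg_right
        (RIS.re_star_dotProduct_mulVec_le (Rc k) h1) (htpos k).le
    have h4 := Real.log_le_sub_one_of_pos h2
    have h5 := Real.one_half_lt_eulerMascheroniConstant
    linarith
  have hVW : Integrable (fun ω => Real.log (T ω) - Real.eulerMascheroniConstant) P →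
      Integrable (fun ω => Real.log (1 + m ω)) P →
      ∫ ω, (Real.log (T ω) - Real.eulerMascheroniConstant) ∂P ≤ ∫ ω, Real.log (1 + m ω) ∂P := by
    have hk := RIS.integral_log_sub_le_integral_log_one_add_mitigation (θ := θ)
      (t := fun k => (Rd k).trace.re) hb hX hind hr_meas hd_meas θ_meas hd_sq hr_hd_indep θ_indep
      Cs_inv (fun k => by rw [hRd])
    exact fun hVi hWi => hk hTpos hWi hVi
  clear_value T N m
  obtain ⟨h1, h2⟩ := RIS.expectation_sub_div_le (A := fun ω => Real.log (N ω))
    (V := fun ω => Real.log (T ω) - Real.eulerMascheroniConstant)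
    (W := fun ω => Real.log (1 + m ω)) (Real.log_pos one_lt_two)
    (Real.measurable_log.comp_aemeasurable hNm)
    ((Real.measurable_log.comp_aemeasurable hTm).sub_const _)
    (Real.measurable_log.comp_aemeasurable (hmm.const_add 1))
    (hm0.mono fun ω h => Real.log_nonneg (by linarith)) hVB hfin hVW
  refine ⟨fun _ => Or.inl ?_, ?_⟩
  · rwa [lintegral_congr_ae (hSEe.mono fun ω hω => by rw [hω, EReal.real_coe_toENNReal])]
  · rw [RIS.expectation_congr hSEe, RIS.expectation_congr hUe]
    exact h2
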